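/- **Setting.** Let $n\ge 2$, $m\ge 1$, $k\ge 0$, let $\Omega\subset\mathbb R^n$ be a bounded polyhedral Lipschitz domain and let $\mathbb T$ be a set of regular triangulations of $\Omega$ into closed simplices. For $T\in\mathcal T\in\mathbb T$ let $\mathcal N(T)$ be the set of vertices and $\mathcal F(T)$ the set of sides of $T$, $h_T=\operatorname{diam}T$, $h_F=\operatorname{diam}F$ for a side $F$, $\mathcal T(z)$ the set of simplices in $\mathcal T$ with vertex $z$, and $\mathcal T(\Omega(T))=\{K\in\mathcal T:\operatorname{dist}(K,T)=0\}$, which covers the closure of $\Omega(T)=\operatorname{int}\bigcup\mathcal T(\Omega(T))$. Let $\mathcal F(\Omega(T))$ consist of the sides shared by two distinct simplices of $\mathcal T(\Omega(T))$ and of the sides $F\subset\partial\Omega$ of simplices of $\mathcal T(\Omega(T))$. Put $M_3=\sup_{T\in\mathcal T\in\mathbb T}|\mathcal T(\Omega(T))|$. Assume (A2) there are finitely many reference patches $\mathcal C_1,\dots,\mathcal C_J$ (finite sets of simplices) such that for all $\mathcal T\in\mathbb T$ and all vertices $z$ of $\mathcal T$, $\mathcal T(z)=z+h\,\mathcal C_j$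 for some $j$ and some $h>0$. For every $\mathcal T\in\mathbb T$ let $V(\mathcal T)\subset P_k(\mathcal T)$ be a vector space of piecewise polynomials of degree at most $k$. Let $D^m$ be the array of all partial derivatives of order $m$ (with the Frobenius norm), $D^m_{\rm NC}$ its piecewise version, and $[D^m w]_F\times\nu_F$ the tangential components along $F$ of the jump of $D^m_{\rm NC}w$ across $F$ (of the trace of $D^m_{\rm NC} w$ if $F\subset\partial\Omega$). Let $J_2:V(\mathcal T)\to H^m_0(\Omega)$ be linear and local: $(J_2v)|_T=J_{2,T}(v|_{\Omega(T)})|_T$ for all $T\in\mathcal T$ and $v\in V(\mathcal T)$, with linear operators $J_{2,T}:V(\mathcal T)|_{\Omega(T)}\to H^m_0(\Omega)$. For $w\in V(\mathcal T)|_{\Omega(T)}$ put $$\mu_T(w)=\Big(\sum_{F\in\mathcal F(\Omega(T))}h_F\|[D^mw]_F\times\nu_F\|_{L^2(F)}^2\Big)^{1/2},\qquad \varrho_T(w)=\|D^m(w-J_{2,T}w)\|_{L^2(T)}.$$ Assume for all $T\in\mathcal T\in\mathbb T$ (C6) $J_{2,T}w=w$ on $T$ for all $w\in(V(\mathcal T)\cap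 H^m_0(\Omega))|_{\Omega(T)}$; (C7) every $w\in V(\mathcal T)|_{\Omega(T)}$ with $\mu_T(w)=0$ belongs to $(V(\mathcal T)\cap H^m_0(\Omega))|_{\Omega(T)}$. Let $C(T)\in[0,\infty]$ be the smallest constant with $\varrho_T\le C(T)\mu_T$ on $V(\mathcal T)|_{\Omega(T)}$ and $C(\mathbb T)=\sup_{T\in\mathcal T\in\mathbb T}C(T)\in[0,\infty]$. **Theorem.** (a) $M_3<\infty$, and $C(T)<\infty$ for all $T\in\mathcal T\in\mathbb T$. (b) Suppose that $V(\mathcal T)|_{\Omega(T)}$ and $J_{2,T}$ depend on the local configuration only, up to translation and scaling. That is, whenever $T\in\mathcal T\in\mathbb T$, $T'\in\mathcal T'\in\mathbb T$ and $\Phi(x)=a+rx$ with $r>0$ maps $T$ to $T'$, $\mathcal T(\Omega(T))$ to $\mathcal T'(\Omega(T'))$, $\mathcal F(\Omega(T))$ to $\mathcal F(\Omega(T'))$, and the vertices of $\mathcal T(\Omega(T))$ on $\partial\Omega$ to those of $\mathcal T'(\Omega(T'))$ on $\partial\Omega$, then $V(\mathcal T)|_{\Omega(T)}=\{w\circ\Phi:w\in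 V(\mathcal T')|_{\Omega(T')}\}$ and $J_{2,T}(w\circ\Phi)=(J_{2,T'}w)\circ\Phi$ on $T$. Then $C(\mathbb T)<\infty$. (c) Let $\mathcal T\in\mathbb T$, let $\widehat{\mathcal T}\in\mathbb T$ be a refinement of $\mathcal T$, and let $\mathcal R=\{K\in\mathcal T:\exists\,T\in\mathcal T\setminus\widehat{\mathcal T},\ \operatorname{dist}(K,T)=0\}$. Let $I_h$ map $V(\widehat{\mathcal T})$ into $V(\mathcal T)$ and $\widehat I_h$ map $H^m_0(\Omega)$ into $V(\widehat{\mathcal T})$, let $u_h\in V(\mathcal T)$, $\widehat u_h^*:=\widehat I_hJ_2u_h$ and $0\le\Lambda_5<\infty$. Assume (C3) $I_h\widehat v_h=\widehat v_h$ on $T$ for all $T\in\mathcal T\cap\widehat{\mathcal T}$ and all $\widehat v_h\in V(\widehat{\mathcal T})$; (C4) $I_h\widehat u_h^*=u_h$; (C5) $\|D^m_{\rm NC}(\widehat I_hv-w_h)\|_{L^2(T)}\le\Lambda_5\|D^m(v-w_h)\|_{L^2(T)}$ for all $T\in\mathcal T$, $v\in H^m_0(\Omega)$, $w_h\in V(\mathcal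 T)$. Then, with $\|\cdot\|_h^2=\sum_{T\in\mathcal T}\|D^m_{\rm NC}\,\cdot\,\|^2_{L^2(T)}$, $$\|\widehat u_h^*-u_h\|_h^2\le\Lambda_2^2\sum_{T\in\mathcal R}h_T\sum_{F\in\mathcal F(T)}\|[D^mu_h]_F\times\nu_F\|_{L^2(F)}^2,\qquad \Lambda_2=\Lambda_5\,C(\mathbb T)\,M_3^{1/2}$$ (an inequality in $[0,\infty]$ with $0\cdot\infty=0$; all quantities in it are finite under the assumption of (b)). -/

import Mathlib

open MeasureTheory
open scoped ENNReal NNReal ContDiff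

/-- Euclidean space `ℝⁿ`. -/
abbrev Eucl (n : ℕ) : Type := EuclideanSpace ℝ (Fin n)

/-- Arrays `(A_α)` with `α ∈ {1,…,n}^i`, with the Euclidean (Frobenius) norm; the values of `D^i`. -/
abbrev DTensor (n i : ℕ) : Type := EuclideanSpace ℝ (Fin i → Fin n)

/-- The (closed) simplex with vertex set `T`. Simplices and sides are represented by their
vertex sets throughout. -/
def hull {n : ℕ} (T : Finset (Eucl n)) : Set (Eucl n) := convexHull ℝ (T : Set (Eucl n))

/-- The diameter `h_T` of a simplex or side, as an extended nonnegative real. -/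
noncomputable def meshSize {n : ℕ} (T : Finset (Eucl n)) : ℝ≥0∞ :=
  ENNReal.ofReal (Metric.diam (hull T))

/-! ### Domains and triangulations -/

/-- Bounded Lipschitz domains: open, connected, bounded sets that are, near each of their boundary
points, the strict epigraph of a Lipschitz function in the direction of some unit vector `e`. -/
structure IsLipschitzDomain {n : ℕ} (Ω : Set (Eucl n)) : Prop where
  isOpen : IsOpen Ω
  isConnected : IsConnected Ω
  isBounded : Bornology.IsBounded Ω
  boundary : ∀ x ∈ frontier Ω, ∃ U ∈ nhds x, ∃ e : Eucl n, ‖e‖ = 1 ∧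
    ∃ (L : ℝ≥0) (g : Eucl n → ℝ), LipschitzWith L g ∧
      (∀ (y : Eucl n) (t : ℝ), g (y + t • e) = g y) ∧
      ∀ y ∈ U, (y ∈ Ω ↔ g y < inner ℝ e y)

/-- Regular triangulations of `Ω` into nondegenerate simplices: two of them
intersect in the convex hull of their common vertices. -/
structure RegularTriangulation {n : ℕ} (Ω : Set (Eucl n)) where
  simplices : Finset (Finset (Eucl n))
  card_eq : ∀ T ∈ simplices, T.card = n + 1
  indep : ∀ T ∈ simplices, AffineIndependent ℝ ((↑) : T → Eucl n)
  inter : ∀ T ∈ simplices, ∀ K ∈ simplices,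
    hull T ∩ hull K = convexHull ℝ ((T : Set (Eucl n)) ∩ (K : Set (Eucl n)))
  cover : ⋃ T ∈ simplices, hull T = closure Ω

/-- The sides of a simplex with `n + 1` vertices. -/
def sides {n : ℕ} (T : Finset (Eucl n)) : Finset (Finset (Eucl n)) := T.powersetCard n

namespace RegularTriangulation

variable {n : ℕ} {Ω : Set (Eucl n)}

/-- The nodal patch `𝒯(z)` of all simplices with vertex `z`. -/
noncomputable def nodalPatch (𝒯 : RegularTriangulation Ω) (z : Eucl n) :
    Finset (Finset (Eucl n)) :=
  open Classical in 𝒯.simplices.filter fun T => z ∈ T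

/-- The set `𝒯(F)` of all simplices with side `F`. -/
noncomputable def sidePatch (𝒯 : RegularTriangulation Ω) (F : Finset (Eucl n)) :
    Finset (Finset (Eucl n)) :=
  open Classical in 𝒯.simplices.filter fun T => F ∈ sides T

/-- The set `𝒯(Ω(T))` of all simplices with distance zero to `T`; as simplices are compact, these
are the simplices that meet `T`. -/
noncomputable def patch (𝒯 : RegularTriangulation Ω) (T : Finset (Eucl n)) :
    Finset (Finset (Eucl n)) :=
  open Classical in 𝒯.simplices.filter fun K => (hull T ∩ hull K).Nonempty

/-- The set `𝓕(Ω(T))`: sides shared by two distinct simplices of `𝒯(Ω(T))`, and sides of simplices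
of `𝒯(Ω(T))` that lie on `∂Ω`. -/
noncomputable def localSides (𝒯 : RegularTriangulation Ω) (T : Finset (Eucl n)) :
    Finset (Finset (Eucl n)) :=
  open Classical in ((𝒯.patch T).biUnion sides).filter fun F =>
    (∃ K₁ ∈ 𝒯.patch T, ∃ K₂ ∈ 𝒯.patch T, K₁ ≠ K₂ ∧ F ∈ sides K₁ ∧ F ∈ sides K₂) ∨
      hull F ⊆ frontier Ω

/-- The vertices of simplices of `𝒯(Ω(T))` that lie on `∂Ω`. -/
noncomputable def localBoundaryVertices (𝒯 : RegularTriangulation Ω) (T : Finset (Eucl n)) :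
    Finset (Eucl n) :=
  open Classical in ((𝒯.patch T).biUnion id).filter fun z => z ∈ frontier Ω

/-- `𝒯'` is a refinement of `𝒯` (both cover the closure of `Ω`). -/
def IsRefinement (𝒯' 𝒯 : RegularTriangulation Ω) : Prop :=
  ∀ K ∈ 𝒯'.simplices, ∃ T ∈ 𝒯.simplices, hull K ⊆ hull T

/-- The set `𝒯 ∖ 𝒯'` of coarse but not fine simplices. -/
noncomputable def refined (𝒯 𝒯' : RegularTriangulation Ω) : Finset (Finset (Eucl n)) :=
  open Classical in 𝒯.simplices \ 𝒯'.simplices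

/-- The set `𝓡`: the simplices of `𝒯` with distance zero to some simplex of `𝒯 ∖ 𝒯'`. -/
noncomputable def refinedLayer (𝒯 𝒯' : RegularTriangulation Ω) : Finset (Finset (Eucl n)) :=
  open Classical in
    𝒯.simplices.filter fun K => ∃ T ∈ 𝒯.refined 𝒯', (hull K ∩ hull T).Nonempty

end RegularTriangulation

/-- The homothety `x ↦ a + r x`. -/
def homothetyMap {n : ℕ} (a : Eucl n) (r : ℝ) (x : Eucl n) : Eucl n := a + r • x

/-- The image of (the vertex set of) a simplex under `x ↦ a + r x`. -/
noncomputable def moveSimplex {n : ℕ} (a : Eucl n) (r : ℝ) (T : Finset (Eucl n)) :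
    Finset (Eucl n) :=
  open Classical in T.image (homothetyMap a r)

/-- The image of a set of simplices under `x ↦ a + r x`. -/
noncomputable def moveSimplices {n : ℕ} (a : Eucl n) (r : ℝ) (S : Finset (Finset (Eucl n))) :
    Finset (Finset (Eucl n)) :=
  open Classical in S.image (moveSimplex a r)

/-- Finitely many patch configurations: there are reference patches `𝒞₁, …, 𝒞_J` such that every
nodal patch in the family is `z + h 𝒞_j` for some `j` and some `h > 0`. -/
def FinitePatchConfigurations {n : ℕ} {Ω : Set (Eucl n)}
    (𝕋 : Set (RegularTriangulation Ω)) : Prop :=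
  ∃ (J : ℕ) (C : Fin J → Finset (Finset (Eucl n))),
    ∀ 𝒯 ∈ 𝕋, ∀ T ∈ 𝒯.simplices, ∀ z ∈ T,
      ∃ (j : Fin J) (h : ℝ), 0 < h ∧ 𝒯.nodalPatch z = moveSimplices z h (C j)

/-- The constant `M₃`, the supremum of `|𝒯(Ω(T))|` over all `T ∈ 𝒯 ∈ 𝕋`. -/
noncomputable def overlapConst {n : ℕ} {Ω : Set (Eucl n)}
    (𝕋 : Set (RegularTriangulation Ω)) : ℝ≥0∞ :=
  ⨆ 𝒯 ∈ 𝕋, ⨆ T ∈ 𝒯.simplices, ((𝒯.patch T).card : ℝ≥0∞)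

/-! ### Derivatives, Sobolev functions and piecewise polynomials -/

/-- The array `D^i f` of all partial derivatives of order `i` of a smooth function. -/
noncomputable def derivTensor {n : ℕ} (i : ℕ) (f : Eucl n → ℝ) (x : Eucl n) : DTensor n i :=
  WithLp.toLp 2 fun α => iteratedFDeriv ℝ i f x fun j => EuclideanSpace.single (α j) (1 : ℝ)

/-- The Sobolev space `H^m_0(Ω)`: the closure in `L²` of the tuples `(φ, Dφ, …, D^m φ)` of test
functions `φ ∈ C_c^∞(Ω)` (which form a vector space). Functions on `Ω` are extended by zero
to `ℝⁿ`, and an element is the tuple of its weak derivatives up to order `m`. -/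
noncomputable def SobolevZero {n : ℕ} (m : ℕ) (Ω : Set (Eucl n)) :
    Submodule ℝ (∀ i : Fin (m + 1), Lp (DTensor n i) 2 (volume : Measure (Eucl n))) :=
  (Submodule.span ℝ {v | ∃ φ : Eucl n → ℝ, ContDiff ℝ ∞ φ ∧ HasCompactSupport φ ∧
    tsupport φ ⊆ Ω ∧ ∀ i : Fin (m + 1), v i =ᵐ[volume] derivTensor (i : ℕ) φ}).topologicalClosure

/-- The function underlying an element of `H^m_0(Ω)`. -/
noncomputable def sobolevFn {n m : ℕ} {Ω : Set (Eucl n)} (v : SobolevZero m Ω) (x : Eucl n) : ℝ :=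
  (v.1 0 : Eucl n → DTensor n 0) x Fin.elim0

/-- The weak derivative `D^m v` of an element of `H^m_0(Ω)`. -/
noncomputable def sobolevDeriv {n m : ℕ} {Ω : Set (Eucl n)} (v : SobolevZero m Ω) (x : Eucl n) :
    DTensor n m :=
  (v.1 (Fin.last m) : Eucl n → DTensor n m) x

/-- Functions given piecewise: `w T` is the smooth function that represents `w` on the simplex `T`. -/
abbrev PiecewiseFun (n : ℕ) : Type := Finset (Eucl n) → Eucl n → ℝ

/-- The restriction of a piecewise function to the union of a set `S` of simplices. -/
noncomputable def restrictTo {n : ℕ} (S : Finset (Finset (Eucl n))) :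
    PiecewiseFun n →ₗ[ℝ] PiecewiseFun n where
  toFun w := open Classical in fun T => if T ∈ S then w T else 0
  map_add' v w := by
    funext T
    by_cases h : T ∈ S <;> simp [h]
  map_smul' c w := by
    funext T
    by_cases h : T ∈ S <;> simp [h]

/-- `w ∈ P_k(S)` for a set `S` of simplices: on each `T ∈ S`, `w` is a polynomial of total degree
at most `k` (and the components for other indices are zero). -/
def IsPiecewisePoly {n : ℕ} (k : ℕ) (S : Finset (Finset (Eucl n))) (w : PiecewiseFun n) : Prop :=
  (∀ T ∈ S, ∃ p : MvPolynomial (Fin n) ℝ, p.totalDegree ≤ k ∧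
    ∀ x : Eucl n, w T x = MvPolynomial.eval (fun i => x i) p) ∧
  ∀ T, T ∉ S → w T = 0

/-- The piecewise function `w` (with respect to `𝒯`) belongs to `H^m_0(Ω)`. -/
def IsConforming {n : ℕ} {Ω : Set (Eucl n)} (m : ℕ) (𝒯 : RegularTriangulation Ω)
    (w : PiecewiseFun n) : Prop :=
  ∃ g : SobolevZero m Ω, ∀ T ∈ 𝒯.simplices, sobolevFn g =ᵐ[volume.restrict (hull T)] w T

/-- The space `V(𝒯)|_{Ω(T)}`. -/
noncomputable def localSpace {n : ℕ} {Ω : Set (Eucl n)}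
    (V : RegularTriangulation Ω → Submodule ℝ (PiecewiseFun n))
    (𝒯 : RegularTriangulation Ω) (T : Finset (Eucl n)) : Submodule ℝ (PiecewiseFun n) :=
  (V 𝒯).map (restrictTo (𝒯.patch T))

/-- The restriction `v|_{Ω(T)}` as an element of `V(𝒯)|_{Ω(T)}`. -/
noncomputable def toLocal {n : ℕ} {Ω : Set (Eucl n)}
    (V : RegularTriangulation Ω → Submodule ℝ (PiecewiseFun n))
    (𝒯 : RegularTriangulation Ω) (T : Finset (Eucl n)) (v : V 𝒯) : localSpace V 𝒯 T :=
  ⟨restrictTo (𝒯.patch T) v, Submodule.mem_map_of_mem v.2⟩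

/-- `w` belongs to `(V(𝒯) ∩ H^m_0(Ω))|_{Ω(T)}`. -/
def IsLocallyConforming {n : ℕ} {Ω : Set (Eucl n)} (m : ℕ)
    (V : RegularTriangulation Ω → Submodule ℝ (PiecewiseFun n))
    (𝒯 : RegularTriangulation Ω) (T : Finset (Eucl n)) (w : PiecewiseFun n) : Prop :=
  ∃ v ∈ V 𝒯, IsConforming m 𝒯 v ∧ restrictTo (𝒯.patch T) v = w

/-! ### Jumps and norms -/

/-- The simplex `T₊` of a side `F`: an arbitrary but fixed element of `𝒯(F)`. Its outer unit normal
along `F` is the fixed orientation `ν_F`. -/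
noncomputable def plusSimplex {n : ℕ} {Ω : Set (Eucl n)} (𝒯 : RegularTriangulation Ω)
    (F : Finset (Eucl n)) : Finset (Eucl n) :=
  open Classical in if h : (𝒯.sidePatch F).Nonempty then h.choose else ∅

/-- The jump `[D^m w]_F`, that is `D^m w|_{T₊} - D^m w|_{T₋}` for `𝒯(F) = {T₊, T₋}`
and `D^m w|_{T₊}` for a boundary side with `𝒯(F) = {T₊}`. -/
noncomputable def derivJump {n : ℕ} {Ω : Set (Eucl n)} (m : ℕ) (𝒯 : RegularTriangulation Ω)
    (F : Finset (Eucl n)) (w : PiecewiseFun n) (x : Eucl n) : DTensor n m :=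
  open Classical in derivTensor m (w (plusSimplex 𝒯 F)) x -
    ∑ K ∈ (𝒯.sidePatch F).erase (plusSimplex 𝒯 F), derivTensor m (w K) x

/-- The tangential components `A × ν_F` of a (symmetric) array `A` along the side `F`: in one of the
indices, the orthogonal projection onto the directions parallel to `F` is applied. It has
the Frobenius norm of the (row-wise) cross product with the unit normal `ν_F`. -/
noncomputable def tangentialPart {n m : ℕ} [NeZero m] (F : Finset (Eucl n)) (A : DTensor n m) :
    DTensor n m :=
  WithLp.toLp 2 fun α =>
    ((vectorSpan ℝ (F : Set (Eucl n))).starProjection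
      (WithLp.toLp 2 fun j => A (Function.update α 0 j))) (α 0)

/-- The norm of `[D^m w]_F × ν_F` in `L²(F)`, with the surface measure on `F`. -/
noncomputable def tangentialJumpNorm {n : ℕ} {Ω : Set (Eucl n)} (m : ℕ) [NeZero m]
    (𝒯 : RegularTriangulation Ω) (F : Finset (Eucl n)) (w : PiecewiseFun n) : ℝ≥0∞ :=
  eLpNorm (fun x => tangentialPart F (derivJump m 𝒯 F w x)) 2 (μHE[n - 1].restrict (hull F))

/-- The norm of `D^m (v - w)` in `L²(T)` for `v ∈ H^m_0(Ω)` and a piecewise smooth `w`. -/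
noncomputable def errorNorm {n m : ℕ} {Ω : Set (Eucl n)} (T : Finset (Eucl n))
    (v : SobolevZero m Ω) (w : PiecewiseFun n) : ℝ≥0∞ :=
  eLpNorm (fun x => sobolevDeriv v x - derivTensor m (w T) x) 2 (volume.restrict (hull T))

/-- The norm of `D^m_NC (v - w)` in `L²(T)` for a simplex `T` of a coarse triangulation, a function
`w` that is piecewise smooth with respect to it and a function `v` that is piecewise smooth with
respect to the fine triangulation `𝒯'`. -/
noncomputable def brokenNorm {n : ℕ} {Ω : Set (Eucl n)} (m : ℕ) (𝒯' : RegularTriangulation Ω)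
    (T : Finset (Eucl n)) (v w : PiecewiseFun n) : ℝ≥0∞ :=
  open Classical in (∑ K ∈ 𝒯'.simplices.filter fun K => hull K ⊆ hull T,
    eLpNorm (fun x => derivTensor m (v K) x - derivTensor m (w T) x) 2
      (volume.restrict (hull K)) ^ 2) ^ (1 / 2 : ℝ)

/-- The discrete norm `‖v - w‖_h` for `v ∈ V(𝒯')` and `w ∈ V(𝒯)`, where `𝒯'` refines `𝒯`. -/
noncomputable def discreteNorm {n : ℕ} {Ω : Set (Eucl n)} (m : ℕ)
    (𝒯 𝒯' : RegularTriangulation Ω) (v w : PiecewiseFun n) : ℝ≥0∞ :=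
  (∑ T ∈ 𝒯.simplices, brokenNorm m 𝒯' T v w ^ 2) ^ (1 / 2 : ℝ)

/-- The seminorm `μ_T`. -/
noncomputable def jumpSeminorm {n : ℕ} {Ω : Set (Eucl n)} (m : ℕ) [NeZero m]
    (𝒯 : RegularTriangulation Ω) (T : Finset (Eucl n)) (w : PiecewiseFun n) : ℝ≥0∞ :=
  (∑ F ∈ 𝒯.localSides T, meshSize F * tangentialJumpNorm m 𝒯 F w ^ 2) ^ (1 / 2 : ℝ)

/-! ### The companion operator and its constants -/

/-- Families of local companion operators `J_{2,T}` on `V(𝒯)|_{Ω(T)}`. -/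
abbrev LocalCompanion {n : ℕ} {Ω : Set (Eucl n)} (m : ℕ)
    (V : RegularTriangulation Ω → Submodule ℝ (PiecewiseFun n)) : Type :=
  ∀ (𝒯 : RegularTriangulation Ω) (T : Finset (Eucl n)), localSpace V 𝒯 T →ₗ[ℝ] SobolevZero m Ω

/-- The constant `C(T)`: the smallest `C` with `ϱ_T ≤ C μ_T` on `V(𝒯)|_{Ω(T)}`, where
`ϱ_T(w)` is the norm of `D^m (w - J_{2,T} w)` in `L²(T)`. -/
noncomputable def companionConst {n m : ℕ} [NeZero m] {Ω : Set (Eucl n)}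
    {V : RegularTriangulation Ω → Submodule ℝ (PiecewiseFun n)} (J : LocalCompanion m V)
    (𝒯 : RegularTriangulation Ω) (T : Finset (Eucl n)) : ℝ≥0∞ :=
  sInf {C | ∀ w : localSpace V 𝒯 T, errorNorm T (J 𝒯 T w) w ≤ C * jumpSeminorm m 𝒯 T w}

/-- The constant `C(𝕋)`, the supremum of `C(T)` over all `T ∈ 𝒯 ∈ 𝕋`. -/
noncomputable def uniformCompanionConst {n m : ℕ} [NeZero m] {Ω : Set (Eucl n)}
    {V : RegularTriangulation Ω → Submodule ℝ (PiecewiseFun n)} (J : LocalCompanion m V)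
    (𝕋 : Set (RegularTriangulation Ω)) : ℝ≥0∞ :=
  ⨆ 𝒯 ∈ 𝕋, ⨆ T ∈ 𝒯.simplices, companionConst J 𝒯 T

/-- The map `x ↦ a + r x` with `r > 0` carries the configuration around `T ∈ 𝒯` to that around
`T' ∈ 𝒯'`: the simplex, its patch, the sides in `𝓕(Ω(T))` and the boundary vertices. -/
structure SameConfiguration {n : ℕ} {Ω : Set (Eucl n)} (a : Eucl n) (r : ℝ)
    (𝒯 : RegularTriangulation Ω) (T : Finset (Eucl n))
    (𝒯' : RegularTriangulation Ω) (T' : Finset (Eucl n)) : Prop where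
  pos : 0 < r
  simplex : moveSimplex a r T = T'
  patch : moveSimplices a r (𝒯.patch T) = 𝒯'.patch T'
  sides : moveSimplices a r (𝒯.localSides T) = 𝒯'.localSides T'
  vertices : moveSimplex a r (𝒯.localBoundaryVertices T) = 𝒯'.localBoundaryVertices T'

/-- The composition of a piecewise function with `x ↦ a + r x`. -/
noncomputable def pullback {n : ℕ} (a : Eucl n) (r : ℝ) (w : PiecewiseFun n) : PiecewiseFun n :=
  fun T x => w (moveSimplex a r T) (homothetyMap a r x)

/-- The local spaces and the local companion operators depend on nothing but the local configuration,
up to translation and scaling: they are compatible with each `x ↦ a + r x` that carries one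
configuration to another. -/
def DeterminedByConfiguration {n m : ℕ} {Ω : Set (Eucl n)}
    {V : RegularTriangulation Ω → Submodule ℝ (PiecewiseFun n)} (J : LocalCompanion m V)
    (𝕋 : Set (RegularTriangulation Ω)) : Prop :=
  ∀ 𝒯 ∈ 𝕋, ∀ T ∈ 𝒯.simplices, ∀ 𝒯' ∈ 𝕋, ∀ T' ∈ 𝒯'.simplices, ∀ (a : Eucl n) (r : ℝ),
    SameConfiguration a r 𝒯 T 𝒯' T' →
      pullback a r '' (localSpace V 𝒯' T' : Set (PiecewiseFun n)) = localSpace V 𝒯 T ∧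
      ∀ (w' : localSpace V 𝒯' T') (w : localSpace V 𝒯 T),
        (w : PiecewiseFun n) = pullback a r w' →
          sobolevFn (J 𝒯 T w) =ᵐ[volume.restrict (hull T)]
            fun x => sobolevFn (J 𝒯' T' w') (homothetyMap a r x)

/-! Local finiteness is a kernel argument. The space `V(𝒯)|_{Ω(T)}` consists of piecewise
polynomials of bounded degree on finitely many simplices, so it is finite-dimensional. On it `μ_T`
dominates the norm of a linear map `A` with the same zeros, and `ϱ_T` is the norm of a linear map
`B`. If `μ_T(w) = 0`, then `w` is conforming by (C7), `J_{2,T} w = w` on `T` by (C6), and uniqueness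
of weak derivatives in the interior of `T` gives `ϱ_T(w) = 0`. Hence `ker A ⊆ ker B`, and `B`
factors through the range of `A` by a bounded map (`LinearMap.exists_norm_le_of_ker_le`,
`exists_companion_bound`).

Uniformity combines scaling with finiteness. Under `x ↦ a + r x`, both `μ_T²` and `ϱ_T²` pick up the
factor `r^(2m-n)`, so the local constant depends on the similarity class of the configuration only
(`companionConst_le_of_sameConfiguration`). Neighbouring reference patches overlap in `T`, which
fixes their relative scales, so finitely many nodal patches leave only finitely many classes
(`exists_finite_movedConfiguration`).

In the final estimate, a non-refined simplex contributes nothing, because there `û* = I û* = u`. On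
a refined simplex, stability of the fine interpolation followed by the local bound gives jumps on
the patch. Summation counts each simplex at most `M₃` times (`sum_refined_patch_le`).

The geometric input is that a jump across a side in `𝓕(Ω(T))` involves simplices of the patch only
(`RegularTriangulation.mem_patch_of_mem_localSides`): at most two simplices share a side, and a
boundary side has just one neighbour because a Lipschitz domain lies on one side of its boundary. -/

/-! ### Weak derivatives -/

section WeakDerivatives

variable {n : ℕ}

/-- The formal adjoint of the partial derivative `∂^α`, applied to a test function. -/
noncomputable def adjDeriv : (i : ℕ) → (Fin i → Fin n) → (Eucl n → ℝ) → Eucl n → ℝ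
  | 0, _, φ => φ
  | i + 1, α, φ => adjDeriv i (Fin.tail α)
      fun x => -fderiv ℝ φ x (EuclideanSpace.single (α 0) (1 : ℝ))

theorem contDiff_neg_partial {φ : Eucl n → ℝ} (hφ : ContDiff ℝ ∞ φ) (v : Eucl n) :
    ContDiff ℝ ∞ fun x => -fderiv ℝ φ x v :=
  ((hφ.fderiv_right (m := ∞) (by simp)).clm_apply contDiff_const).neg

theorem tsupport_neg_partial_subset (φ : Eucl n → ℝ) (v : Eucl n) :
    tsupport (fun x => -fderiv ℝ φ x v) ⊆ tsupport φ := by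
  refine closure_minimal ?_ (isClosed_tsupport φ)
  intro x hx
  by_contra hx'
  apply hx
  have : fderiv ℝ φ x = 0 := by
    have := (notMem_tsupport_iff_eventuallyEq.1 hx').fderiv_eq (𝕜 := ℝ)
    rw [this]; simp
  simp [this]

theorem contDiff_adjDeriv (i : ℕ) (α : Fin i → Fin n) {φ : Eucl n → ℝ} (hφ : ContDiff ℝ ∞ φ) :
    ContDiff ℝ ∞ (adjDeriv i α φ) := by
  induction i generalizing φ with
  | zero => exact hφ
  | succ i ih => exact ih _ (contDiff_neg_partial hφ _)

theorem tsupport_adjDeriv_subset (i : ℕ) (α : Fin i → Fin n) (φ : Eucl n → ℝ) :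
    tsupport (adjDeriv i α φ) ⊆ tsupport φ := by
  induction i generalizing φ with
  | zero => exact subset_rfl
  | succ i ih => exact (ih _ _).trans (tsupport_neg_partial_subset φ _)

theorem hasCompactSupport_of_tsupport_subset {φ ψ : Eucl n → ℝ} (hφ : HasCompactSupport φ)
    (h : tsupport ψ ⊆ tsupport φ) : HasCompactSupport ψ :=
  hφ.mono' ((subset_tsupport ψ).trans h)

theorem hasCompactSupport_adjDeriv (i : ℕ) (α : Fin i → Fin n) {φ : Eucl n → ℝ}
    (hφ : HasCompactSupport φ) : HasCompactSupport (adjDeriv i α φ) :=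
  hasCompactSupport_of_tsupport_subset hφ (tsupport_adjDeriv_subset i α φ)

theorem contDiff_derivTensor (i : ℕ) {f : Eucl n → ℝ} (hf : ContDiff ℝ ∞ f) :
    ContDiff ℝ ∞ (derivTensor i f) := by
  unfold derivTensor
  rw [contDiff_euclidean]
  intro α
  have h : ContDiff ℝ ∞ (iteratedFDeriv ℝ i f) := hf.iteratedFDeriv_right (m := ∞) (by exact_mod_cast le_top)
  exact (ContinuousMultilinearMap.apply ℝ (fun _ : Fin i => Eucl n) ℝ
    (fun j => EuclideanSpace.single (α j) (1 : ℝ))).contDiff.comp h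

/-- The index `α 0` belongs to the outermost derivative. This matches the order in which `adjDeriv`
peels off derivatives. -/
theorem derivTensor_succ_apply (i : ℕ) {f : Eucl n → ℝ} (hf : ContDiff ℝ ∞ f)
    (α : Fin (i + 1) → Fin n) (x : Eucl n) :
    derivTensor (i + 1) f x α =
      fderiv ℝ (fun y => derivTensor i f y (Fin.tail α)) x
        (EuclideanSpace.single (α 0) (1 : ℝ)) := by
  have h : ContDiff ℝ ∞ (iteratedFDeriv ℝ i f) := hf.iteratedFDeriv_right (m := ∞) (by exact_mod_cast le_top)
  have hd : DifferentiableAt ℝ (iteratedFDeriv ℝ i f) x :=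
    (h.differentiable (by simp)).differentiableAt
  set A := ContinuousMultilinearMap.apply ℝ (fun _ : Fin i => Eucl n) ℝ
    (fun j => EuclideanSpace.single (Fin.tail α j) (1 : ℝ)) with hA
  have : (fun y => derivTensor i f y (Fin.tail α)) = A ∘ iteratedFDeriv ℝ i f := by
    funext y; rfl
  rw [this, (A.hasFDerivAt.comp x hd.hasFDerivAt).fderiv]
  simp only [derivTensor, iteratedFDeriv_succ_apply_left]
  rfl

/-- Repeated integration by parts, one outermost derivative at a time. The signs are absorbed into
`adjDeriv`, and the compact support of `φ` alone removes boundary terms. -/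
theorem integral_derivTensor_mul (i : ℕ) {f φ : Eucl n → ℝ} (hf : ContDiff ℝ ∞ f)
    (hφ : ContDiff ℝ ∞ φ) (hφc : HasCompactSupport φ) (α : Fin i → Fin n) :
    ∫ x, derivTensor i f x α * φ x = ∫ x, f x * adjDeriv i α φ x := by
  induction i generalizing φ with
  | zero => simp [derivTensor, adjDeriv]
  | succ i ih =>
    have hψ := contDiff_neg_partial hφ (EuclideanSpace.single (α 0) (1 : ℝ))
    have hψc := hasCompactSupport_of_tsupport_subset hφc
      (tsupport_neg_partial_subset φ (EuclideanSpace.single (α 0) (1 : ℝ)))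
    rw [adjDeriv, ← ih hψ hψc (Fin.tail α)]
    have hg : ContDiff ℝ ∞ (fun y => derivTensor i f y (Fin.tail α)) :=
      contDiff_euclidean.1 (contDiff_derivTensor i hf) _
    simp only [derivTensor_succ_apply i hf, mul_neg]
    rw [integral_neg, integral_mul_fderiv_eq_neg_fderiv_mul_of_integrable, neg_neg]
    · exact Continuous.integrable_of_hasCompactSupport
        (((hg.continuous_fderiv (by simp)).clm_apply continuous_const).mul hφ.continuous)
        hφc.mul_left
    · have := Continuous.integrable_of_hasCompactSupport (μ := volume)
        (hg.continuous.mul hψ.continuous) hψc.mul_left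
      refine this.neg.congr (Filter.Eventually.of_forall fun x => ?_)
      simp
    · exact Continuous.integrable_of_hasCompactSupport
        (hg.continuous.mul hφ.continuous) hφc.mul_left
    · exact fun x _ => (hg.differentiable (by simp)).differentiableAt
    · exact fun x _ => (hφ.differentiable (by simp)).differentiableAt

/-- `d` is the array of weak derivatives of order `i` of `u` on the whole space. -/
structure HasWeakDeriv (i : ℕ) (u : Eucl n → ℝ) (d : Eucl n → DTensor n i) : Prop where
  locallyIntegrable : ∀ α, LocallyIntegrable (fun x => d x α)
  integral_eq : ∀ φ : Eucl n → ℝ, ContDiff ℝ ∞ φ → HasCompactSupport φ → ∀ α,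
    ∫ x, d x α * φ x = ∫ x, u x * adjDeriv i α φ x

theorem ContDiff.hasWeakDeriv (i : ℕ) {f : Eucl n → ℝ} (hf : ContDiff ℝ ∞ f) :
    HasWeakDeriv i f (derivTensor i f) where
  locallyIntegrable α :=
    (contDiff_euclidean.1 (contDiff_derivTensor i hf) α).continuous.locallyIntegrable
  integral_eq _ hφ hφc α := integral_derivTensor_mul i hf hφ hφc α

/-- Locality and uniqueness by the fundamental lemma of the calculus of variations: `adjDeriv` does
not enlarge supports, so a test function supported in `U` sees only the values of `u₁` and `u₂` on
`U`. -/
theorem HasWeakDeriv.ae_eq {i : ℕ} {u₁ u₂ : Eucl n → ℝ} {d₁ d₂ : Eucl n → DTensor n i}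
    (h₁ : HasWeakDeriv i u₁ d₁) (h₂ : HasWeakDeriv i u₂ d₂) {U : Set (Eucl n)} (hU : IsOpen U)
    (hu : u₁ =ᵐ[volume.restrict U] u₂) : d₁ =ᵐ[volume.restrict U] d₂ := by
  have key : ∀ α, ∀ᵐ x, x ∈ U → d₁ x α - d₂ x α = 0 := by
    intro α
    have hl := (h₁.locallyIntegrable α).sub (h₂.locallyIntegrable α)
    refine hU.ae_eq_zero_of_integral_contDiff_smul_eq_zero (hl.locallyIntegrableOn U) ?_
    intro φ hφ hφc hφU
    have hint : ∀ {d : Eucl n → DTensor n i}, LocallyIntegrable (fun x => d x α) →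
        Integrable fun x => d x α * φ x := by
      intro d hd
      simpa [mul_comm] using hd.integrable_smul_left_of_hasCompactSupport hφ.continuous hφc
    have : ∫ x, d₁ x α * φ x = ∫ x, d₂ x α * φ x := by
      rw [h₁.integral_eq φ hφ hφc, h₂.integral_eq φ hφ hφc]
      refine integral_congr_ae ?_
      filter_upwards [(ae_restrict_iff' hU.measurableSet).1 hu] with x hx
      by_cases hxU : x ∈ U
      · simp [hx hxU]
      · have : adjDeriv i α φ x = 0 := image_eq_zero_of_notMem_tsupport fun h =>
          hxU (hφU (tsupport_adjDeriv_subset i α φ h))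
        simp [this]
    rw [← sub_eq_zero, ← integral_sub (hint (h₁.locallyIntegrable α))
      (hint (h₂.locallyIntegrable α))] at this
    rw [← this]
    refine integral_congr_ae (Filter.Eventually.of_forall fun x => ?_)
    simp only [smul_eq_mul]
    ring
  refine (ae_restrict_iff' hU.measurableSet).2 ?_
  filter_upwards [ae_all_iff.2 key] with x hx hxU
  ext α
  exact sub_eq_zero.1 (hx α hxU)

theorem fderiv_comp_homothetyMap {f : Eucl n → ℝ} (hf : Differentiable ℝ f) (a : Eucl n) (r : ℝ)
    (x v : Eucl n) : fderiv ℝ (fun y => f (homothetyMap a r y)) x v =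
      r * fderiv ℝ f (homothetyMap a r x) v := by
  have h1 : HasFDerivAt (homothetyMap a r) (r • ContinuousLinearMap.id ℝ (Eucl n)) x := by
    unfold homothetyMap
    exact ((hasFDerivAt_id x).const_smul r).const_add a
  have h2 : fderiv ℝ (fun y => f (homothetyMap a r y)) x = _ :=
    ((hf (homothetyMap a r x)).hasFDerivAt.comp x h1).fderiv
  rw [h2]
  simp

theorem adjDeriv_comp_homothety (i : ℕ) (α : Fin i → Fin n) (a : Eucl n) (r : ℝ)
    {φ : Eucl n → ℝ} (hφ : ContDiff ℝ ∞ φ) (x : Eucl n) :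
    adjDeriv i α (fun y => φ (homothetyMap a r y)) x =
      r ^ i * adjDeriv i α φ (homothetyMap a r x) := by
  induction i generalizing φ with
  | zero => simp [adjDeriv]
  | succ i ih =>
    -- Homogeneity of the adjoint, needed to pull out the factor `r` that the chain rule produces
    -- for each derivative.
    have hsmul : ∀ (c : ℝ) (ψ : Eucl n → ℝ), ContDiff ℝ ∞ ψ → ∀ (j : ℕ) (β : Fin j → Fin n) y,
        adjDeriv j β (fun x => c * ψ x) y = c * adjDeriv j β ψ y := by
      intro c ψ hψ j β y
      induction j generalizing ψ with
      | zero => rfl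
      | succ j ihj =>
        rw [adjDeriv, adjDeriv, ← ihj _ (contDiff_neg_partial hψ _)]
        congr 1
        funext z
        rw [fderiv_const_mul ((hψ.differentiable (by simp)).differentiableAt)]
        simp
    rw [adjDeriv, adjDeriv]
    have : (fun x => -fderiv ℝ (fun y => φ (homothetyMap a r y)) x
          (EuclideanSpace.single (α 0) (1 : ℝ))) =
        fun x => r * (fun y => -fderiv ℝ φ y (EuclideanSpace.single (α 0) (1 : ℝ)))
          (homothetyMap a r x) := by
      funext y
      rw [fderiv_comp_homothetyMap (hφ.differentiable (by simp))]
      simp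
    have hψ := contDiff_neg_partial hφ (EuclideanSpace.single (α 0) (1 : ℝ))
    have hψ' : ContDiff ℝ ∞ fun x => (fun y => -fderiv ℝ φ y
        (EuclideanSpace.single (α 0) (1 : ℝ))) (homothetyMap a r x) :=
      hψ.comp (contDiff_const.add (contDiff_id.const_smul r))
    rw [this, hsmul _ _ hψ', ih (Fin.tail α) hψ]
    ring

theorem integral_comp_homothetyMap (f : Eucl n → ℝ) (a : Eucl n) (r : ℝ) :
    ∫ x, f (homothetyMap a r x) = |(r ^ n)⁻¹| * ∫ x, f x := by
  have h := Measure.integral_comp_smul (volume : Measure (Eucl n)) (fun x => f (a + x)) r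
  rw [integral_add_left_eq_self f a] at h
  simpa [homothetyMap] using h

theorem homothetyMap_leftInverse (a : Eucl n) {r : ℝ} (hr : r ≠ 0) (x : Eucl n) :
    homothetyMap (-(r⁻¹ • a)) r⁻¹ (homothetyMap a r x) = x := by
  simp [homothetyMap, smul_smul, hr]

theorem homothetyMap_rightInverse (a : Eucl n) {r : ℝ} (hr : r ≠ 0) (x : Eucl n) :
    homothetyMap a r (homothetyMap (-(r⁻¹ • a)) r⁻¹ x) = x := by
  simp [homothetyMap, smul_smul, hr]

theorem continuous_homothetyMap (a : Eucl n) (r : ℝ) : Continuous (homothetyMap a r) :=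
  continuous_const.add (continuous_id.const_smul r)

theorem contDiff_homothetyMap (a : Eucl n) (r : ℝ) : ContDiff ℝ ∞ (homothetyMap a r) :=
  contDiff_const.add (contDiff_id.const_smul r)

/-- The homothety `x ↦ a + r x` with `r ≠ 0` as a homeomorphism. -/
noncomputable def homothetyHomeomorph (a : Eucl n) {r : ℝ} (hr : r ≠ 0) : Eucl n ≃ₜ Eucl n where
  toFun := homothetyMap a r
  invFun := homothetyMap (-(r⁻¹ • a)) r⁻¹
  left_inv := homothetyMap_leftInverse a hr
  right_inv := homothetyMap_rightInverse a hr
  continuous_toFun := continuous_homothetyMap _ _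
  continuous_invFun := continuous_homothetyMap _ _

theorem LocallyIntegrable.comp_homothetyMap {f : Eucl n → ℝ} (hf : LocallyIntegrable f)
    (a : Eucl n) {r : ℝ} (hr : r ≠ 0) : LocallyIntegrable fun x => f (homothetyMap a r x) := by
  rw [locallyIntegrable_iff]
  intro K hK
  have hK' : IsCompact (homothetyMap a r '' K) := hK.image (continuous_homothetyMap a r)
  have h := locallyIntegrable_iff.1 hf _ hK'
  rw [← integrable_indicator_iff hK'.measurableSet] at h
  rw [← integrable_indicator_iff hK.measurableSet]
  have h2 := (h.comp_add_left a).comp_smul hr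
  refine h2.congr (Filter.Eventually.of_forall fun x => ?_)
  have hinj : Function.Injective (homothetyMap a r) := (homothetyHomeomorph a hr).injective
  by_cases hx : x ∈ K
  · simp only [Set.indicator_of_mem hx]
    exact Set.indicator_of_mem (show a + r • x ∈ homothetyMap a r '' K from ⟨x, hx, rfl⟩) f
  · simp only [Set.indicator_of_notMem hx]
    refine Set.indicator_of_notMem ?_ f
    rintro ⟨y, hy, hxy⟩
    exact hx (hinj hxy ▸ hy)

/-- Transport the test function by the inverse homothety and change variables; the Jacobian is the
same on both sides. -/
theorem HasWeakDeriv.comp_homothetyMap {i : ℕ} {u : Eucl n → ℝ} {d : Eucl n → DTensor n i}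
    (h : HasWeakDeriv i u d) (a : Eucl n) {r : ℝ} (hr : r ≠ 0) :
    HasWeakDeriv i (fun x => u (homothetyMap a r x)) fun x => r ^ i • d (homothetyMap a r x) where
  locallyIntegrable α := by
    exact (LocallyIntegrable.comp_homothetyMap (h.locallyIntegrable α) a hr).smul (r ^ i)
  integral_eq φ hφ hφc α := by
    set ψ : Eucl n → ℝ := fun x => φ (homothetyMap (-(r⁻¹ • a)) r⁻¹ x) with hψdef
    have hψ : ContDiff ℝ ∞ ψ := hφ.comp (contDiff_homothetyMap _ _)
    have hψc : HasCompactSupport ψ :=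
      hφc.comp_homeomorph (homothetyHomeomorph a hr).symm
    have hφψ : φ = fun x => ψ (homothetyMap a r x) := by
      funext x; simp [hψdef, homothetyMap_leftInverse a hr]
    have h1 : ∫ x, (r ^ i • d (homothetyMap a r x)) α * φ x =
        ∫ x, (fun y => r ^ i * (d y α * ψ y)) (homothetyMap a r x) := by
      rw [hφψ]; simp [mul_assoc]
    have h2 : ∫ x, u (homothetyMap a r x) * adjDeriv i α φ x =
        ∫ x, (fun y => r ^ i * (u y * adjDeriv i α ψ y)) (homothetyMap a r x) := by
      rw [hφψ]
      simp only [adjDeriv_comp_homothety i α a r hψ]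
      congr 1; funext x; ring
    rw [h1, h2, integral_comp_homothetyMap (fun y => r ^ i * (d y α * ψ y)),
      integral_comp_homothetyMap (fun y => r ^ i * (u y * adjDeriv i α ψ y)), integral_const_mul,
      integral_const_mul, h.integral_eq ψ hψ hψc]

/-- Pairing of an `L²` array with a test function in one component. -/
theorem exists_component_pairing {i : ℕ} (α : Fin i → Fin n) {ψ : Eucl n → ℝ}
    (hψ : Continuous ψ) (hψc : HasCompactSupport ψ) :
    ∃ ℓ : Lp (DTensor n i) 2 (volume : Measure (Eucl n)) →L[ℝ] ℝ,
      ∀ v, ℓ v = ∫ x, (v : Eucl n → DTensor n i) x α * ψ x := by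
  have hm : MemLp (fun x => (EuclideanSpace.single α (ψ x) : DTensor n i)) 2
      (volume : Measure (Eucl n)) := by
    refine Continuous.memLp_of_hasCompactSupport ?_ ?_
    · rw [show (fun x => (EuclideanSpace.single α (ψ x) : DTensor n i)) =
        fun x => ψ x • (EuclideanSpace.single α (1 : ℝ) : DTensor n i) by
          funext x; ext j; simp]
      exact hψ.smul continuous_const
    · exact hψc.comp_left (g := fun t => (EuclideanSpace.single α t : DTensor n i)) (by simp)
  refine ⟨innerSL ℝ (hm.toLp _), fun v => ?_⟩
  rw [innerSL_apply_apply, L2.inner_def]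
  refine integral_congr_ae ?_
  filter_upwards [hm.coeFn_toLp] with x hx
  rw [hx, EuclideanSpace.inner_single_left]
  simp [mul_comm]

/-- Both sides are continuous functionals of the tuple `g`, so the identity passes from test
functions to their closed span. Here `φ` need not be supported in `Ω`: the extension by zero has
weak derivatives on all of `ℝⁿ`. -/
theorem integral_sobolevZero_mul {m : ℕ} {Ω : Set (Eucl n)} (g : SobolevZero m Ω)
    (i : Fin (m + 1)) {φ : Eucl n → ℝ} (hφ : ContDiff ℝ ∞ φ) (hφc : HasCompactSupport φ)
    (α : Fin i → Fin n) :
    ∫ x, (g.1 i : Eucl n → DTensor n i) x α * φ x = ∫ x, sobolevFn g x * adjDeriv i α φ x := by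
  obtain ⟨ℓ₁, h₁⟩ := exists_component_pairing α hφ.continuous hφc
  obtain ⟨ℓ₂, h₂⟩ := exists_component_pairing
    (i := ((0 : Fin (m + 1)) : ℕ)) Fin.elim0
    (contDiff_adjDeriv i α hφ).continuous (hasCompactSupport_adjDeriv i α hφc)
  let L : (∀ i : Fin (m + 1), Lp (DTensor n i) 2 (volume : Measure (Eucl n))) →L[ℝ] ℝ :=
    ℓ₁.comp (ContinuousLinearMap.proj i) - ℓ₂.comp (ContinuousLinearMap.proj 0)
  have hker : SobolevZero m Ω ≤ LinearMap.ker L.toLinearMap := by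
    refine Submodule.topologicalClosure_minimal _ ?_ L.isClosed_ker
    refine Submodule.span_le.2 ?_
    rintro v ⟨f, hf, -, -, hv⟩
    have e₁ : ℓ₁ (v i) = ∫ x, derivTensor i f x α * φ x := by
      rw [h₁]
      refine integral_congr_ae ?_
      filter_upwards [hv i] with x hx
      rw [hx]
    have e₂ : ℓ₂ (v 0) = ∫ x, f x * adjDeriv i α φ x := by
      refine (h₂ _).trans (integral_congr_ae ?_)
      filter_upwards [hv 0] with x hx
      rw [hx]
      exact congrArg (· * adjDeriv (i : ℕ) α φ x) (iteratedFDeriv_zero_apply _)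
    change ℓ₁ (v i) - ℓ₂ (v 0) = 0
    rw [e₁, e₂, integral_derivTensor_mul i hf hφ hφc, sub_self]
  have hg : ℓ₁ (g.1 i) - ℓ₂ (g.1 0) = 0 := hker g.2
  exact (h₁ _).symm.trans ((sub_eq_zero.1 hg).trans (h₂ _))

theorem hasWeakDeriv_sobolevDeriv {m : ℕ} {Ω : Set (Eucl n)} (g : SobolevZero m Ω) :
    HasWeakDeriv m (sobolevFn g) (sobolevDeriv g) where
  locallyIntegrable α := by
    have h : MemLp (sobolevDeriv g) 2 volume := Lp.memLp (g.1 (Fin.last m))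
    have h' : MemLp (fun x => sobolevDeriv g x α) 2 volume :=
      (EuclideanSpace.proj (𝕜 := ℝ) α).comp_memLp' h
    exact h'.locallyIntegrable (by norm_num)
  integral_eq φ hφ hφc α := integral_sobolevZero_mul g (Fin.last m) hφ hφc α

end WeakDerivatives

/-! ### Simplices as sets -/

section Hull

variable {n : ℕ}

theorem isCompact_hull (T : Finset (Eucl n)) : IsCompact (hull T) :=
  T.finite_toSet.isCompact_convexHull ℝ

theorem convex_hull (T : Finset (Eucl n)) : Convex ℝ (hull T) := convex_convexHull ℝ _

theorem mem_hull {T : Finset (Eucl n)} {z : Eucl n} (hz : z ∈ T) : z ∈ hull T :=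
  subset_convexHull ℝ _ hz

/-- The boundary of a convex set is a null set. This transfers the uniqueness of weak derivatives
from open sets to closed simplices. -/
theorem restrict_interior_hull (T : Finset (Eucl n)) :
    (volume : Measure (Eucl n)).restrict (interior (hull T)) = volume.restrict (hull T) :=
  Measure.restrict_congr_set (interior_ae_eq_of_null_frontier ((convex_hull T).addHaar_frontier _))

theorem HasWeakDeriv.ae_eq_hull {i : ℕ} {u₁ u₂ : Eucl n → ℝ} {d₁ d₂ : Eucl n → DTensor n i}
    (h₁ : HasWeakDeriv i u₁ d₁) (h₂ : HasWeakDeriv i u₂ d₂) {T : Finset (Eucl n)}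
    (hu : u₁ =ᵐ[volume.restrict (hull T)] u₂) : d₁ =ᵐ[volume.restrict (hull T)] d₂ := by
  rw [← restrict_interior_hull] at hu ⊢
  exact h₁.ae_eq h₂ isOpen_interior hu

/-- The hull of `d + 1` points lies in the affine, hence Lipschitz, image of the unit cube of `ℝ^d`,
with vertices corresponding to the origin and the unit vectors. No affine independence is involved.
-/
theorem euclideanHausdorffMeasure_hull_lt_top {d : ℕ} {F : Finset (Eucl n)}
    (hF : F.card = d + 1) : μHE[d] (hull F) < ⊤ := by
  obtain e := F.equivFinOfCardEq hF
  let f : Fin (d + 1) → Eucl n := fun i => e.symm i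
  let L : (Fin d → ℝ) →ₗ[ℝ] Eucl n := Fintype.linearCombination ℝ fun i => f i.succ - f 0
  let L' : (Fin d → ℝ) →L[ℝ] Eucl n := L.toContinuousLinearMap
  let G : (Fin d → ℝ) → Eucl n := fun x => f 0 + L' x
  have hG : LipschitzWith ‖L'‖₊ G := by
    have h := (LipschitzWith.const (α := Fin d → ℝ) (f 0)).add L'.lipschitz
    simpa [G] using h
  have hsub : hull F ⊆ G '' Set.Icc 0 1 := by
    refine convexHull_min ?_ ?_
    · intro z hz
      obtain ⟨i, hi⟩ : ∃ i, f i = z := ⟨e ⟨z, hz⟩, by simp [f]⟩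
      induction i using Fin.cases with
      | zero => exact ⟨0, ⟨le_rfl, zero_le_one⟩, by simp [G, hi]⟩
      | succ i =>
        refine ⟨Pi.single i 1, ⟨?_, ?_⟩, ?_⟩
        · exact Pi.single_nonneg.2 zero_le_one
        · intro j
          by_cases h : j = i
          · subst h; simp
          · simp [h]
        · simp [G, L', L, Fintype.linearCombination_apply_single, hi]
    · have hI : Convex ℝ (Set.Icc (0 : Fin d → ℝ) 1) := convex_Icc _ _
      have h := (hI.linear_image L).vadd (f 0)
      convert h using 1
      ext z
      simp [G, L', Set.mem_vadd_set]
  have hfin : μH[(d : ℝ)] (hull F) < ⊤ := by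
    refine (measure_mono hsub).trans_lt ((hG.hausdorffMeasure_image_le (by positivity) _).trans_lt ?_)
    have hv : (μH[(d : ℝ)] : Measure (Fin d → ℝ)) = volume := by
      simpa using hausdorffMeasure_pi_real (ι := Fin d)
    rw [hv]
    exact ENNReal.mul_lt_top (ENNReal.rpow_lt_top_of_nonneg (by positivity) ENNReal.coe_ne_top)
      isCompact_Icc.measure_lt_top
  rw [Measure.euclideanHausdorffMeasure_def, Measure.smul_apply]
  exact ENNReal.mul_lt_top ENNReal.coe_lt_top hfin

theorem Continuous.memLp_restrict_hull {E : Type*} [NormedAddCommGroup E]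
    [SecondCountableTopologyEither (Eucl n) E]
    {g : Eucl n → E} (hg : Continuous g) {μ : Measure (Eucl n)} {T : Finset (Eucl n)}
    (hμ : μ (hull T) < ⊤) : MemLp g 2 (μ.restrict (hull T)) := by
  obtain ⟨C, hC⟩ := (isCompact_hull T).exists_bound_of_continuousOn hg.continuousOn
  have : IsFiniteMeasure (μ.restrict (hull T)) := ⟨by simpa using hμ⟩
  exact MemLp.of_bound hg.aestronglyMeasurable C
    ((ae_restrict_iff' (isCompact_hull T).measurableSet).2 (Filter.Eventually.of_forall hC))

end Hull

/-! ### Linearity of jumps -/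

section Jumps

variable {n : ℕ}

theorem derivTensor_add (i : ℕ) {f g : Eucl n → ℝ} (hf : ContDiff ℝ ∞ f) (hg : ContDiff ℝ ∞ g)
    (x : Eucl n) : derivTensor i (f + g) x = derivTensor i f x + derivTensor i g x := by
  have h : iteratedFDeriv ℝ i (f + g) x = iteratedFDeriv ℝ i f x + iteratedFDeriv ℝ i g x :=
    iteratedFDeriv_add_apply (hf.contDiffAt.of_le (by exact_mod_cast le_top))
      (hg.contDiffAt.of_le (by exact_mod_cast le_top))
  ext α
  simp [derivTensor, h]

theorem derivTensor_smul (i : ℕ) (c : ℝ) {f : Eucl n → ℝ} (hf : ContDiff ℝ ∞ f)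
    (x : Eucl n) : derivTensor i (c • f) x = c • derivTensor i f x := by
  have h : iteratedFDeriv ℝ i (c • f) x = c • iteratedFDeriv ℝ i f x :=
    iteratedFDeriv_const_smul_apply (hf.contDiffAt.of_le (by exact_mod_cast le_top))
  ext α
  simp [derivTensor, h]

/-- The map `A ↦ A × ν_F` as a continuous linear map. -/
noncomputable def tangentialPartCLM {m : ℕ} [NeZero m] (F : Finset (Eucl n)) :
    DTensor n m →L[ℝ] DTensor n m :=
  LinearMap.toContinuousLinearMap
    { toFun := tangentialPart F
      map_add' := by
        intro A B
        ext α
        have : (WithLp.toLp 2 fun j => (A + B) (Function.update α 0 j) : Eucl n) =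
            (WithLp.toLp 2 fun j => A (Function.update α 0 j)) +
              WithLp.toLp 2 fun j => B (Function.update α 0 j) := by
          ext j; simp
        refine (congrArg (fun v : Eucl n => ((vectorSpan ℝ (F : Set (Eucl n))).starProjection v)
          (α 0)) this).trans ?_
        rw [map_add]
        rfl
      map_smul' := by
        intro c A
        ext α
        have : (WithLp.toLp 2 fun j => (c • A) (Function.update α 0 j) : Eucl n) =
            c • (WithLp.toLp 2 fun j => A (Function.update α 0 j)) := by
          ext j; simp
        refine (congrArg (fun v : Eucl n => ((vectorSpan ℝ (F : Set (Eucl n))).starProjection v)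
          (α 0)) this).trans ?_
        rw [map_smul]
        rfl }

theorem tangentialPartCLM_apply {m : ℕ} [NeZero m] (F : Finset (Eucl n)) (A : DTensor n m) :
    tangentialPartCLM F A = tangentialPart F A := rfl

variable {Ω : Set (Eucl n)}

theorem derivJump_add (m : ℕ) (𝒯 : RegularTriangulation Ω) (F : Finset (Eucl n))
    {v w : PiecewiseFun n} (hv : ∀ K, ContDiff ℝ ∞ (v K)) (hw : ∀ K, ContDiff ℝ ∞ (w K))
    (x : Eucl n) : derivJump m 𝒯 F (v + w) x = derivJump m 𝒯 F v x + derivJump m 𝒯 F w x := by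
  simp only [derivJump, Pi.add_apply, derivTensor_add m (hv _) (hw _), Finset.sum_add_distrib]
  abel

theorem derivJump_smul (m : ℕ) (𝒯 : RegularTriangulation Ω) (F : Finset (Eucl n)) (c : ℝ)
    {w : PiecewiseFun n} (hw : ∀ K, ContDiff ℝ ∞ (w K))
    (x : Eucl n) : derivJump m 𝒯 F (c • w) x = c • derivJump m 𝒯 F w x := by
  simp only [derivJump, Pi.smul_apply, derivTensor_smul m c (hw _), ← Finset.smul_sum, smul_sub]

theorem continuous_derivJump (m : ℕ) (𝒯 : RegularTriangulation Ω) (F : Finset (Eucl n))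
    {w : PiecewiseFun n} (hw : ∀ K, ContDiff ℝ ∞ (w K)) : Continuous (derivJump m 𝒯 F w) :=
  (contDiff_derivTensor m (hw _)).continuous.sub
    (continuous_finsetSum _ fun K _ => (contDiff_derivTensor m (hw K)).continuous)

end Jumps

/-! ### Piecewise polynomials -/

section Polynomials

variable {n : ℕ}

theorem contDiff_eval_mvPolynomial (p : MvPolynomial (Fin n) ℝ) :
    ContDiff ℝ ∞ fun x : Eucl n => MvPolynomial.eval (fun i => x i) p := by
  induction p using MvPolynomial.induction_on with
  | C a => simpa using contDiff_const
  | add p q hp hq => simpa using hp.add hq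
  | mul_X p i hp =>
    simpa using hp.mul (EuclideanSpace.proj (𝕜 := ℝ) i).contDiff

theorem IsPiecewisePoly.contDiff {k : ℕ} {S : Finset (Finset (Eucl n))} {w : PiecewiseFun n}
    (hw : IsPiecewisePoly k S w) (K : Finset (Eucl n)) : ContDiff ℝ ∞ (w K) := by
  by_cases hK : K ∈ S
  · obtain ⟨p, -, hp⟩ := hw.1 K hK
    rw [show w K = fun x : Eucl n => MvPolynomial.eval (fun i => x i) p from funext hp]
    exact contDiff_eval_mvPolynomial p
  · rw [hw.2 K hK]
    exact contDiff_const

/-- `W` lies in the image of a finite product of polynomial spaces of bounded total degree, one for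
each simplex in `S`. -/
theorem finiteDimensional_of_isPiecewisePoly {k : ℕ} {S : Finset (Finset (Eucl n))}
    (W : Submodule ℝ (PiecewiseFun n)) (hW : ∀ w ∈ W, IsPiecewisePoly k S w) :
    FiniteDimensional ℝ W := by
  classical
  let ev : MvPolynomial (Fin n) ℝ →ₗ[ℝ] (Eucl n → ℝ) :=
    { toFun := fun p x => MvPolynomial.eval (fun i => x i) p
      map_add' := fun p q => by funext x; simp
      map_smul' := fun c p => by funext x; simp [MvPolynomial.smul_eval] }
  let Ψ : (S → MvPolynomial.restrictTotalDegree (Fin n) ℝ k) →ₗ[ℝ] PiecewiseFun n :=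
    LinearMap.pi fun T => if h : T ∈ S then
      ev ∘ₗ (MvPolynomial.restrictTotalDegree (Fin n) ℝ k).subtype ∘ₗ LinearMap.proj ⟨T, h⟩
      else 0
  have hle : W ≤ LinearMap.range Ψ := by
    intro w hw
    obtain ⟨h1, h2⟩ := hW w hw
    choose p hp hpe using h1
    refine ⟨fun T => ⟨p T T.2, (MvPolynomial.mem_restrictTotalDegree _ _ _).2 (hp T T.2)⟩, ?_⟩
    funext T
    by_cases h : T ∈ S
    · funext x
      simp [Ψ, h, ev, hpe T h x]
    · simp [Ψ, h, h2 T h]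
  exact Submodule.finiteDimensional_of_le hle

variable {Ω : Set (Eucl n)} {V : RegularTriangulation Ω → Submodule ℝ (PiecewiseFun n)}

theorem isPiecewisePoly_of_mem_localSpace {k : ℕ} {𝒯 : RegularTriangulation Ω}
    (hV : ∀ v ∈ V 𝒯, IsPiecewisePoly k 𝒯.simplices v) (T : Finset (Eucl n))
    {w : PiecewiseFun n} (hw : w ∈ localSpace V 𝒯 T) : IsPiecewisePoly k (𝒯.patch T) w := by
  obtain ⟨v, hv, rfl⟩ := hw
  refine ⟨fun K hK => ?_, fun K hK => ?_⟩
  · obtain ⟨p, hp, hpe⟩ := (hV v hv).1 K (by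
      simp only [RegularTriangulation.patch, Finset.mem_filter] at hK; exact hK.1)
    exact ⟨p, hp, fun x => by simpa [restrictTo, hK] using hpe x⟩
  · simp [restrictTo, hK]

end Polynomials

/-! ### Membership in patches -/

namespace RegularTriangulation

variable {n : ℕ} {Ω : Set (Eucl n)} {𝒯 : RegularTriangulation Ω} {T K F : Finset (Eucl n)}

theorem mem_nodalPatch {z : Eucl n} : T ∈ 𝒯.nodalPatch z ↔ T ∈ 𝒯.simplices ∧ z ∈ T := by
  classical
  simp [nodalPatch]

theorem mem_sidePatch : T ∈ 𝒯.sidePatch F ↔ T ∈ 𝒯.simplices ∧ F ∈ sides T := by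
  classical
  simp [sidePatch]

theorem mem_patch : K ∈ 𝒯.patch T ↔ K ∈ 𝒯.simplices ∧ (hull T ∩ hull K).Nonempty := by
  classical
  simp [patch]

theorem mem_localSides : F ∈ 𝒯.localSides T ↔ (∃ K ∈ 𝒯.patch T, F ∈ sides K) ∧
    ((∃ K₁ ∈ 𝒯.patch T, ∃ K₂ ∈ 𝒯.patch T, K₁ ≠ K₂ ∧ F ∈ sides K₁ ∧ F ∈ sides K₂) ∨
      hull F ⊆ frontier Ω) := by
  classical
  simp [localSides]

theorem mem_refined {𝒯' : RegularTriangulation Ω} :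
    T ∈ 𝒯.refined 𝒯' ↔ T ∈ 𝒯.simplices ∧ T ∉ 𝒯'.simplices := by
  classical
  simp [refined]

theorem mem_refinedLayer {𝒯' : RegularTriangulation Ω} :
    K ∈ 𝒯.refinedLayer 𝒯' ↔
      K ∈ 𝒯.simplices ∧ ∃ T ∈ 𝒯.refined 𝒯', (hull K ∩ hull T).Nonempty := by
  classical
  simp [refinedLayer]

end RegularTriangulation

theorem mem_sides {n : ℕ} {T F : Finset (Eucl n)} : F ∈ sides T ↔ F ⊆ T ∧ F.card = n :=
  Finset.mem_powersetCard

/-! ### Finiteness of the local constants -/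

section LocalConstant

theorem LinearMap.exists_norm_le_of_ker_le {W E G : Type*} [AddCommGroup W] [Module ℝ W]
    [FiniteDimensional ℝ W] [NormedAddCommGroup E] [NormedSpace ℝ E] [NormedAddCommGroup G]
    [NormedSpace ℝ G] (A : W →ₗ[ℝ] E) (B : W →ₗ[ℝ] G)
    (h : LinearMap.ker A ≤ LinearMap.ker B) : ∃ C : ℝ, 0 ≤ C ∧ ∀ w, ‖B w‖ ≤ C * ‖A w‖ := by
  -- With a linear section `s` of `A` over its range, `B ∘ s` satisfies `B = (B ∘ s) ∘ A` by the
  -- kernel inclusion, and it is bounded since the range is finite-dimensional.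
  obtain ⟨s, hs⟩ := A.rangeRestrict.exists_rightInverse_of_surjective A.range_rangeRestrict
  let L : LinearMap.range A →L[ℝ] G := LinearMap.toContinuousLinearMap (B ∘ₗ s)
  refine ⟨‖L‖, L.opNorm_nonneg, fun w => ?_⟩
  have hw : B w = L (A.rangeRestrict w) := by
    have hmem : w - s (A.rangeRestrict w) ∈ LinearMap.ker A := by
      have := congrArg Subtype.val (LinearMap.congr_fun hs (A.rangeRestrict w))
      have h2 : A (s (A.rangeRestrict w)) = A w := this
      simp [h2]
    have := h hmem
    rw [LinearMap.mem_ker, map_sub, sub_eq_zero] at this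
    exact this
  rw [hw]
  exact L.le_opNorm _

/-- A linear map into functions in `L²`, as a linear map into the space `L²`. -/
noncomputable def LinearMap.toLpTwo {X W E : Type*} [MeasurableSpace X] {μ : Measure X}
    [AddCommGroup W] [Module ℝ W] [NormedAddCommGroup E] [NormedSpace ℝ E] (L : W → X → E)
    (hadd : ∀ v w, L (v + w) = L v + L w) (hsmul : ∀ (c : ℝ) w, L (c • w) = c • L w)
    (hL : ∀ w, MemLp (L w) 2 μ) : W →ₗ[ℝ] Lp E 2 μ where
  toFun w := (hL w).toLp (L w)
  map_add' v w := by
    rw [← MemLp.toLp_add]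
    exact MemLp.toLp_congr _ _ (by rw [hadd])
  map_smul' c w := by
    rw [RingHom.id_apply, ← MemLp.toLp_const_smul]
    exact MemLp.toLp_congr _ _ (by rw [hsmul])

theorem LinearMap.enorm_toLpTwo {X W E : Type*} [MeasurableSpace X] {μ : Measure X}
    [AddCommGroup W] [Module ℝ W] [NormedAddCommGroup E] [NormedSpace ℝ E] (L : W → X → E)
    (hadd : ∀ v w, L (v + w) = L v + L w) (hsmul : ∀ (c : ℝ) w, L (c • w) = c • L w)
    (hL : ∀ w, MemLp (L w) 2 μ) (w : W) :
    ‖LinearMap.toLpTwo L hadd hsmul hL w‖ₑ = eLpNorm (L w) 2 μ :=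
  Lp.enorm_toLp (hL w)

theorem errorNorm_eq_zero {n m : ℕ} {Ω : Set (Eucl n)} (T : Finset (Eucl n)) (v : SobolevZero m Ω) {w : PiecewiseFun n}
    (hw : ContDiff ℝ ∞ (w T)) (h : sobolevFn v =ᵐ[volume.restrict (hull T)] w T) :
    errorNorm T v w = 0 := by
  have h' := (hasWeakDeriv_sobolevDeriv v).ae_eq_hull (hw.hasWeakDeriv m) h
  unfold errorNorm
  rw [eLpNorm_congr_ae (g := 0), eLpNorm_zero]
  filter_upwards [h'] with x hx
  simp [hx]

/-- The error sees nothing but the values on `T`, by uniqueness of weak derivatives. This allows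
`J₂` to be exchanged for `J_{2,T}`. -/
theorem errorNorm_congr {n m : ℕ} {Ω : Set (Eucl n)} (T : Finset (Eucl n)) {v v' : SobolevZero m Ω} {w w' : PiecewiseFun n}
    (hv : sobolevFn v =ᵐ[volume.restrict (hull T)] sobolevFn v') (hw : w T = w' T) :
    errorNorm T v w = errorNorm T v' w' := by
  have h' := (hasWeakDeriv_sobolevDeriv v).ae_eq_hull (hasWeakDeriv_sobolevDeriv v') hv
  refine eLpNorm_congr_ae ?_
  filter_upwards [h'] with x hx
  simp [hx, hw]

variable {n m : ℕ} [NeZero m] {Ω : Set (Eucl n)}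
  {V : RegularTriangulation Ω → Submodule ℝ (PiecewiseFun n)}

/-- The infimum is itself admissible. Where `b i = 0`, any admissible constant forces `a i = 0`;
elsewhere one divides by the finite nonzero `b i`. -/
theorem le_sInf_mul {ι : Type*} {a b : ι → ℝ≥0∞} (hb : ∀ i, b i ≠ ⊤) (i : ι)
    (hne : {C : ℝ≥0∞ | ∀ i, a i ≤ C * b i}.Nonempty) :
    a i ≤ sInf {C : ℝ≥0∞ | ∀ i, a i ≤ C * b i} * b i := by
  by_cases h0 : b i = 0
  · obtain ⟨C, hC⟩ := hne
    have := hC i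
    simpa [h0] using this
  · rw [← ENNReal.div_le_iff h0 (hb i)]
    exact le_sInf fun C hC => (ENNReal.div_le_iff h0 (hb i)).2 (hC i)

theorem card_of_mem_localSides {𝒯 : RegularTriangulation Ω} {T F : Finset (Eucl n)}
    (hF : F ∈ 𝒯.localSides T) : F.card = n := by
  obtain ⟨⟨K, -, h⟩, -⟩ := RegularTriangulation.mem_localSides.1 hF
  exact (mem_sides.1 h).2

theorem memLp_tangentialJump (hn : 2 ≤ n) (𝒯 : RegularTriangulation Ω) {F : Finset (Eucl n)}
    (hF : F.card = n) {w : PiecewiseFun n} (hw : ∀ K, ContDiff ℝ ∞ (w K)) :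
    MemLp (fun x => tangentialPart F (derivJump m 𝒯 F w x)) 2 (μHE[n - 1].restrict (hull F)) := by
  have hc : Continuous fun x => tangentialPartCLM F (derivJump m 𝒯 F w x) :=
    (tangentialPartCLM F).continuous.comp (continuous_derivJump m 𝒯 F hw)
  exact hc.memLp_restrict_hull (euclideanHausdorffMeasure_hull_lt_top (by omega))

theorem sq_rpow_half (x : ℝ≥0∞) : (x ^ 2) ^ (1 / 2 : ℝ) = x := by
  rw [← ENNReal.rpow_natCast, ← ENNReal.rpow_mul]; norm_num

theorem rpow_half_sq (x : ℝ≥0∞) : (x ^ (1 / 2 : ℝ)) ^ 2 = x := by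
  rw [← ENNReal.rpow_natCast, ← ENNReal.rpow_mul]; norm_num

theorem jumpSeminorm_ne_top (hn : 2 ≤ n) (𝒯 : RegularTriangulation Ω) (T : Finset (Eucl n))
    {w : PiecewiseFun n} (hw : ∀ K, ContDiff ℝ ∞ (w K)) : jumpSeminorm m 𝒯 T w ≠ ⊤ := by
  refine ENNReal.rpow_ne_top_of_nonneg (by norm_num) (ENNReal.sum_lt_top.2 fun F hF => ?_).ne
  exact ENNReal.mul_lt_top ENNReal.ofReal_lt_top
    (ENNReal.pow_lt_top (memLp_tangentialJump hn 𝒯 (card_of_mem_localSides hF) hw).2)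

/-- A finite constant `C` with `ϱ_T ≤ C μ_T`. -/
theorem exists_companion_bound {k : ℕ} (hn : 2 ≤ n) {𝒯 : RegularTriangulation Ω}
    (hV : ∀ v ∈ V 𝒯, IsPiecewisePoly k 𝒯.simplices v) (J : LocalCompanion m V)
    (T : Finset (Eucl n))
    (hC6 : ∀ w : localSpace V 𝒯 T, IsLocallyConforming m V 𝒯 T w →
      sobolevFn (J 𝒯 T w) =ᵐ[volume.restrict (hull T)] (w : PiecewiseFun n) T)
    (hC7 : ∀ w : localSpace V 𝒯 T, jumpSeminorm m 𝒯 T w = 0 → IsLocallyConforming m V 𝒯 T w) :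
    ∃ C : ℝ≥0∞, C < ⊤ ∧ ∀ w : localSpace V 𝒯 T,
      errorNorm T (J 𝒯 T w) w ≤ C * jumpSeminorm m 𝒯 T w := by
  have hpoly : ∀ w ∈ localSpace V 𝒯 T, IsPiecewisePoly k (𝒯.patch T) w :=
    fun w hw => isPiecewisePoly_of_mem_localSpace hV T hw
  have hsm : ∀ (w : localSpace V 𝒯 T) K, ContDiff ℝ ∞ ((w : PiecewiseFun n) K) :=
    fun w => (hpoly w w.2).contDiff
  have : FiniteDimensional ℝ (localSpace V 𝒯 T) :=
    finiteDimensional_of_isPiecewisePoly _ hpoly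
  let A₀ : ∀ F : 𝒯.localSides T,
      localSpace V 𝒯 T →ₗ[ℝ] Lp (DTensor n m) 2 (μHE[n - 1].restrict (hull F.1)) := fun F =>
    LinearMap.toLpTwo
      (fun w x => tangentialPart F.1 (derivJump m 𝒯 F.1 (w : PiecewiseFun n) x))
      (fun v w => by
        funext x
        simp only [Submodule.coe_add, Pi.add_apply, derivJump_add m 𝒯 F.1 (hsm v) (hsm w),
          ← tangentialPartCLM_apply, map_add])
      (fun c w => by
        funext x
        simp only [Submodule.coe_smul, Pi.smul_apply, derivJump_smul m 𝒯 F.1 c (hsm w),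
          ← tangentialPartCLM_apply, map_smul])
      (fun w => memLp_tangentialJump hn 𝒯 (card_of_mem_localSides F.2) (hsm w))
  have hA₀ : ∀ F w, ‖A₀ F w‖ₑ = tangentialJumpNorm m 𝒯 F.1 w := fun F w =>
    LinearMap.enorm_toLpTwo _ _ _ _ w
  -- The weight `h_F^(1/2)` makes the squared component norms the summands of `μ_T²`. The product
  -- carries the supremum norm, so `‖A w‖ ≤ μ_T(w)` only, but the zeros coincide and this direction
  -- suffices.
  let A := LinearMap.pi fun F : 𝒯.localSides T =>
    Real.sqrt (Metric.diam (hull F.1)) • A₀ F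
  have hAF : ∀ F w, ‖A w F‖ₑ ^ 2 = meshSize F.1 * tangentialJumpNorm m 𝒯 F.1 w ^ 2 := by
    intro F w
    change ‖Real.sqrt (Metric.diam (hull F.1)) • A₀ F w‖ₑ ^ 2 = _
    rw [enorm_smul, mul_pow, hA₀, Real.enorm_eq_ofReal (Real.sqrt_nonneg _),
      ← ENNReal.ofReal_pow (Real.sqrt_nonneg _), Real.sq_sqrt Metric.diam_nonneg]
    rfl
  have hA : ∀ w, ‖A w‖ₑ ≤ jumpSeminorm m 𝒯 T w := by
    intro w
    obtain ⟨c, hc⟩ := WithTop.ne_top_iff_exists.1 (jumpSeminorm_ne_top (m := m) hn 𝒯 T (hsm w))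
    change (c : ℝ≥0∞) = _ at hc
    rw [← hc, enorm_le_coe, pi_nnnorm_le_iff]
    intro F
    rw [← enorm_le_coe, hc, ← sq_rpow_half ‖A w F‖ₑ, hAF]
    refine ENNReal.rpow_le_rpow ?_ (by norm_num)
    exact Finset.single_le_sum (f := fun F => meshSize F * tangentialJumpNorm m 𝒯 F w ^ 2)
      (fun _ _ => zero_le) F.2
  -- `B₁ w` is the weak derivative of `J_{2,T} w` on `T`, and `B₂ w` below is the classical
  -- derivative of `w` there.
  let B₁ : localSpace V 𝒯 T →ₗ[ℝ] Lp (DTensor n m) 2 (volume.restrict (hull T)) :=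
    (LpToLpRestrictCLM (Eucl n) (DTensor n m) ℝ volume 2 (hull T)).toLinearMap ∘ₗ
      (LinearMap.proj (Fin.last m) : (∀ i : Fin (m + 1),
        Lp (DTensor n i) 2 (volume : Measure (Eucl n))) →ₗ[ℝ] _) ∘ₗ
      (SobolevZero m Ω).subtype ∘ₗ J 𝒯 T
  have hB₂mem : ∀ w : localSpace V 𝒯 T, MemLp (derivTensor m ((w : PiecewiseFun n) T)) 2
      (volume.restrict (hull T)) := fun w =>
    (contDiff_derivTensor m (hsm w T)).continuous.memLp_restrict_hull
      (isCompact_hull T).measure_lt_top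
  let B₂ : localSpace V 𝒯 T →ₗ[ℝ] Lp (DTensor n m) 2 (volume.restrict (hull T)) :=
    LinearMap.toLpTwo (fun w => derivTensor m ((w : PiecewiseFun n) T))
      (fun v w => by funext x; exact derivTensor_add m (hsm v T) (hsm w T) x)
      (fun c w => by funext x; exact derivTensor_smul m c (hsm w T) x)
      hB₂mem
  have hB : ∀ w, ‖(B₁ - B₂) w‖ₑ = errorNorm T (J 𝒯 T w) w := by
    intro w
    rw [Lp.enorm_def]
    refine eLpNorm_congr_ae ?_
    have h1 : (B₁ w : Eucl n → DTensor n m) =ᵐ[volume.restrict (hull T)]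
        sobolevDeriv (J 𝒯 T w) := LpToLpRestrictCLM_coeFn ℝ (hull T) _
    have h2 : (B₂ w : Eucl n → DTensor n m) =ᵐ[volume.restrict (hull T)]
        derivTensor m ((w : PiecewiseFun n) T) := (hB₂mem w).coeFn_toLp
    rw [LinearMap.sub_apply]
    filter_upwards [Lp.coeFn_sub (B₁ w) (B₂ w), h1, h2] with x hx h1 h2
    rw [hx, Pi.sub_apply, h1, h2]
  have hker : LinearMap.ker A ≤ LinearMap.ker (B₁ - B₂) := by
    intro w hw
    have hμ : jumpSeminorm m 𝒯 T w = 0 := by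
      have : ∑ F ∈ 𝒯.localSides T, meshSize F * tangentialJumpNorm m 𝒯 F w ^ 2 = 0 := by
        refine Finset.sum_eq_zero fun F hF => ?_
        rw [← hAF ⟨F, hF⟩ w, LinearMap.mem_ker.1 hw]
        simp
      rw [jumpSeminorm, this, ENNReal.zero_rpow_of_pos (by norm_num)]
    have h0 := errorNorm_eq_zero T (J 𝒯 T w) (hsm w T) (hC6 w (hC7 w hμ))
    rw [← hB, enorm_eq_zero] at h0
    exact h0
  obtain ⟨C, hC0, hC⟩ := LinearMap.exists_norm_le_of_ker_le A (B₁ - B₂) hker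
  refine ⟨ENNReal.ofReal C, ENNReal.ofReal_lt_top, fun w => ?_⟩
  rw [← hB]
  calc ‖(B₁ - B₂) w‖ₑ = ENNReal.ofReal ‖(B₁ - B₂) w‖ := (ofReal_norm _).symm
    _ ≤ ENNReal.ofReal (C * ‖A w‖) := ENNReal.ofReal_le_ofReal (hC w)
    _ = ENNReal.ofReal C * ‖A w‖ₑ := by rw [ENNReal.ofReal_mul hC0, ofReal_norm]
    _ ≤ _ := by gcongr; exact hA w

end LocalConstant

/-! ### Geometry of regular triangulations -/

section Geometry

variable {n : ℕ} {Ω : Set (Eucl n)}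

theorem affineMap_sum_smul {ι : Type*} (s : Finset ι) (f : Eucl n →ᵃ[ℝ] ℝ) (w : ι → ℝ)
    (p : ι → Eucl n) (hw : ∑ i ∈ s, w i = 1) :
    f (∑ i ∈ s, w i • p i) = ∑ i ∈ s, w i * f (p i) := by
  have hf : ∀ y, f y = f.linear y + f 0 := fun y => by
    simpa using f.map_vadd 0 y
  have h : ∑ i ∈ s, w i * f (p i) = ∑ i ∈ s, (w i * f.linear (p i) + w i * f 0) :=
    Finset.sum_congr rfl fun i _ => by rw [hf (p i)]; ring
  rw [hf, h, Finset.sum_add_distrib, ← Finset.sum_mul, hw, one_mul, map_sum]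
  simp

/-- `c` is the family of barycentric coordinates of the nondegenerate simplex `K`. -/
structure IsBarycentric (K : Finset (Eucl n)) (c : Eucl n → (Eucl n →ᵃ[ℝ] ℝ)) : Prop where
  self : ∀ p ∈ K, c p p = 1
  ne : ∀ p ∈ K, ∀ q ∈ K, p ≠ q → c p q = 0
  mem_hull : ∀ x, (∀ p ∈ K, 0 ≤ c p x) → x ∈ hull K
  eq_sum : ∀ (f : Eucl n →ᵃ[ℝ] ℝ) (x : Eucl n), f x = ∑ p ∈ K, c p x * f p

theorem exists_isBarycentric {K : Finset (Eucl n)} (hcard : K.card = n + 1)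
    (hind : AffineIndependent ℝ ((↑) : K → Eucl n)) : ∃ c, IsBarycentric K c := by
  classical
  have htop : affineSpan ℝ (Set.range ((↑) : K → Eucl n)) = ⊤ := by
    rw [hind.affineSpan_eq_top_iff_card_eq_finrank_add_one]
    simp [hcard]
  let b : AffineBasis K ℝ (Eucl n) := ⟨((↑) : K → Eucl n), hind, htop⟩
  have hb : ∀ p : K, b p = p := fun _ => rfl
  have hsum : ∀ g : Eucl n → ℝ, ∀ x, ∑ p ∈ K, (if h : p ∈ K then b.coord ⟨p, h⟩ x else 0) * g p =
      ∑ p : K, b.coord p x * g p := by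
    intro g x
    rw [← Finset.sum_coe_sort K]
    exact Finset.sum_congr rfl fun p _ => by simp
  refine ⟨fun p => if h : p ∈ K then b.coord ⟨p, h⟩ else 0, ?_, ?_, ?_, ?_⟩
  · intro p hp
    simpa [hp, hb] using b.coord_apply_eq (⟨p, hp⟩ : K)
  · intro p hp q hq hpq
    have : (⟨p, hp⟩ : K) ≠ ⟨q, hq⟩ := fun h => hpq (congrArg Subtype.val h)
    simpa [hp, hb] using b.coord_apply_ne this
  · intro x hx
    have h : x ∈ convexHull ℝ (Set.range b) := by
      rw [b.convexHull_eq_nonneg_coord]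
      intro p
      simpa using hx p p.2
    have hr : Set.range b = (K : Set (Eucl n)) := by
      ext z
      simp [hb]
    rwa [hr] at h
  · intro f x
    have h1 : f x = ∑ p : K, b.coord p x * f p := by
      conv_lhs => rw [← b.linear_combination_coord_eq_self x]
      exact affineMap_sum_smul _ f _ _ (b.sum_coord_apply_eq_one x)
    rw [h1, ← hsum (fun p => f p) x]
    refine Finset.sum_congr rfl fun p hp => ?_
    simp [hp]

theorem IsBarycentric.eq_zero_of_mem_convexHull {K : Finset (Eucl n)}
    {c : Eucl n → (Eucl n →ᵃ[ℝ] ℝ)} (hc : IsBarycentric K c) {S : Set (Eucl n)} (hS : S ⊆ K)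
    {p : Eucl n} (hp : p ∈ K) (hpS : p ∉ S) {x : Eucl n} (hx : x ∈ convexHull ℝ S) :
    c p x = 0 := by
  have hconv : Convex ℝ ((c p) ⁻¹' {0}) := (convex_singleton (0 : ℝ)).affine_preimage (c p)
  have hsub : S ⊆ (c p) ⁻¹' {0} := fun q hq =>
    hc.ne p hp q (hS hq) fun h => hpS (h ▸ hq)
  exact convexHull_min hsub hconv hx

theorem IsBarycentric.apply_centroid {F K : Finset (Eucl n)} {c : Eucl n → (Eucl n →ᵃ[ℝ] ℝ)}
    (hc : IsBarycentric K c) (hFK : F ⊆ K) (hn : 0 < n) (hF : F.card = n) {p : Eucl n}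
    (hp : p ∈ F) : c p (F.centerMass (fun _ => (1 : ℝ)) id) = (n : ℝ)⁻¹ := by
  classical
  have h1 : ∑ _i ∈ F, (1 : ℝ) = n := by simp [hF]
  have hn' : (n : ℝ) ≠ 0 := by positivity
  have h2 : F.centerMass (fun _ => (1 : ℝ)) id = ∑ q ∈ F, (n : ℝ)⁻¹ • q := by
    rw [Finset.centerMass, h1, Finset.smul_sum]
    simp
  have h3 : c p (∑ q ∈ F, (n : ℝ)⁻¹ • q) = ∑ q ∈ F, (n : ℝ)⁻¹ * c p q :=
    affineMap_sum_smul F (c p) (fun _ => (n : ℝ)⁻¹) id (by simp [hF, hn'])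
  rw [h2, h3, Finset.sum_eq_single p]
  · rw [hc.self p (hFK hp), mul_one]
  · intro q hq hqp
    rw [hc.ne p (hFK hp) q (hFK hq) hqp.symm, mul_zero]
  · exact fun h => absurd hp h

theorem centerMass_mem_hull {F : Finset (Eucl n)} (hn : 0 < n) (hF : F.card = n) :
    F.centerMass (fun _ => (1 : ℝ)) id ∈ hull F := by
  refine Finset.centerMass_mem_convexHull F (fun _ _ => zero_le_one) ?_ fun i hi => hi
  simpa [hF] using hn

theorem exists_insert_of_mem_sides {K F : Finset (Eucl n)} (hK : K.card = n + 1)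
    (hF : F ∈ sides K) : ∃ a ∈ K, a ∉ F ∧ ∀ p ∈ K, p = a ∨ p ∈ F := by
  classical
  obtain ⟨hFK, hFc⟩ := mem_sides.1 hF
  have h1 : (K \ F).card = 1 := by rw [Finset.card_sdiff_of_subset hFK, hK, hFc]; omega
  obtain ⟨a, ha⟩ := Finset.card_eq_one.1 h1
  have hmem : ∀ p, p ∈ K \ F ↔ p = a := fun p => by rw [ha]; simp
  refine ⟨a, (Finset.mem_sdiff.1 ((hmem a).2 rfl)).1, (Finset.mem_sdiff.1 ((hmem a).2 rfl)).2, ?_⟩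
  intro p hp
  by_cases hpF : p ∈ F
  · exact Or.inr hpF
  · exact Or.inl ((hmem p).1 (Finset.mem_sdiff.2 ⟨hp, hpF⟩))

namespace RegularTriangulation

variable {𝒯 : RegularTriangulation Ω} {T K K₁ K₂ K₃ F : Finset (Eucl n)}

/-- Distinct sets of `n + 1` vertices share at most `n` of them, and `F` already accounts for `n`.
-/
theorem inter_eq_of_mem_sides (h₁ : K₁ ∈ 𝒯.simplices) (h₂ : K₂ ∈ 𝒯.simplices) (hne : K₁ ≠ K₂)
    (hF₁ : F ∈ sides K₁) (hF₂ : F ∈ sides K₂) :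
    (K₁ : Set (Eucl n)) ∩ (K₂ : Set (Eucl n)) = F := by
  classical
  obtain ⟨hFK₁, hFc⟩ := mem_sides.1 hF₁
  obtain ⟨hFK₂, -⟩ := mem_sides.1 hF₂
  have hsub : F ⊆ K₁ ∩ K₂ := Finset.subset_inter hFK₁ hFK₂
  have hle : (K₁ ∩ K₂).card ≤ F.card := by
    by_contra hlt
    have h1 : K₁ ∩ K₂ = K₁ := Finset.eq_of_subset_of_card_le Finset.inter_subset_left (by
      rw [𝒯.card_eq _ h₁]; omega)
    have h2 : K₁ ⊆ K₂ := Finset.inter_eq_left.1 h1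
    exact hne (Finset.eq_of_subset_of_card_le h2 (by rw [𝒯.card_eq _ h₁, 𝒯.card_eq _ h₂]))
  have := Finset.eq_of_subset_of_card_le hsub hle
  rw [this, Finset.coe_inter]

/-- Two simplices with a common side lie on opposite sides of it. -/
theorem coord_apex_neg (hn : 0 < n) (h₁ : K₁ ∈ 𝒯.simplices) (h₂ : K₂ ∈ 𝒯.simplices)
    (hne : K₁ ≠ K₂) (hF₁ : F ∈ sides K₁) (hF₂ : F ∈ sides K₂)
    {c₁ c₂ : Eucl n → (Eucl n →ᵃ[ℝ] ℝ)} (hc₁ : IsBarycentric K₁ c₁) (hc₂ : IsBarycentric K₂ c₂)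
    {a₁ a₂ : Eucl n} (ha₁ : a₁ ∈ K₁) (hK₁ : ∀ p ∈ K₁, p = a₁ ∨ p ∈ F) (ha₁F : a₁ ∉ F)
    (ha₂ : a₂ ∈ K₂) (ha₂F : a₂ ∉ F) : c₁ a₁ a₂ < 0 := by
  obtain ⟨hFK₁, hFc⟩ := mem_sides.1 hF₁
  obtain ⟨hFK₂, -⟩ := mem_sides.1 hF₂
  -- Otherwise a short step from the centroid `z` of `F` towards `a₂` stays in both simplices, hence
  -- in the hull of `F` by regularity. Yet the barycentric coordinate of `a₂` in `K₂` is positive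
  -- there and vanishes on that hull.
  by_contra! hpos
  set z := F.centerMass (fun _ => (1 : ℝ)) id with hz
  have hzF : z ∈ hull F := centerMass_mem_hull hn hFc
  have hline : ∀ (f : Eucl n →ᵃ[ℝ] ℝ) (t : ℝ),
      f (AffineMap.lineMap z a₂ t) = (1 - t) * f z + t * f a₂ := by
    intro f t
    rw [AffineMap.apply_lineMap, AffineMap.lineMap_apply_module]
    simp
  have hev : ∀ᶠ t in nhds (0 : ℝ), ∀ p ∈ F, 0 < (1 - t) * c₁ p z + t * c₁ p a₂ := by
    rw [Filter.eventually_all_finset]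
    intro p hp
    have hcont : Continuous fun t : ℝ => (1 - t) * c₁ p z + t * c₁ p a₂ := by fun_prop
    refine hcont.tendsto 0 |>.eventually (lt_mem_nhds ?_)
    have := hc₁.apply_centroid hFK₁ hn hFc hp
    simp only [sub_zero, one_mul, zero_mul, add_zero, hz, this]
    positivity
  obtain ⟨ε, hε, hball⟩ := Metric.eventually_nhds_iff.1 hev
  set t := min (ε / 2) 1 with ht
  have ht0 : 0 < t := by positivity
  have ht1 : t ≤ 1 := min_le_right _ _
  have htε : dist t 0 < ε := by
    rw [Real.dist_0_eq_abs, abs_of_pos ht0]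
    exact (min_le_left _ _).trans_lt (by linarith)
  have htF := hball htε
  have hx₁ : AffineMap.lineMap z a₂ t ∈ hull K₁ := by
    refine hc₁.mem_hull _ fun p hp => ?_
    rw [hline]
    rcases hK₁ p hp with rfl | hpF
    · have h0 : c₁ p z = 0 := hc₁.eq_zero_of_mem_convexHull (S := F) hFK₁ hp ha₁F hzF
      rw [h0]
      have := mul_nonneg ht0.le hpos
      linarith
    · exact (htF p hpF).le
  have hx₂ : AffineMap.lineMap z a₂ t ∈ hull K₂ := by
    have hzK : z ∈ hull K₂ := convexHull_mono (by exact_mod_cast hFK₂) hzF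
    exact (convex_hull K₂).lineMap_mem hzK (mem_hull ha₂) ⟨ht0.le, ht1⟩
  have hx : AffineMap.lineMap z a₂ t ∈ convexHull ℝ (F : Set (Eucl n)) := by
    rw [← inter_eq_of_mem_sides h₁ h₂ hne hF₁ hF₂, ← 𝒯.inter K₁ h₁ K₂ h₂]
    exact ⟨hx₁, hx₂⟩
  have e1 := hc₂.eq_zero_of_mem_convexHull (S := F) hFK₂ ha₂ ha₂F hx
  rw [hline, hc₂.self a₂ ha₂, hc₂.eq_zero_of_mem_convexHull (S := F) hFK₂ ha₂ ha₂F hzF] at e1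
  linarith

/-- An affine function that vanishes on the vertices of `F` is determined by its value at the
opposite vertex `a₂`. -/
theorem coord_apex_eq_mul (hF₁ : F ⊆ K₁)
    {c₁ c₂ : Eucl n → (Eucl n →ᵃ[ℝ] ℝ)} (hc₁ : IsBarycentric K₁ c₁) (hc₂ : IsBarycentric K₂ c₂)
    {a₁ a₂ : Eucl n} (ha₁ : a₁ ∈ K₁) (ha₁F : a₁ ∉ F)
    (ha₂ : a₂ ∈ K₂) (hK₂ : ∀ p ∈ K₂, p = a₂ ∨ p ∈ F) (x : Eucl n) :
    c₁ a₁ x = c₂ a₂ x * c₁ a₁ a₂ := by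
  rw [hc₂.eq_sum (c₁ a₁) x, Finset.sum_eq_single a₂]
  · intro p hp hpa
    have hpF := (hK₂ p hp).resolve_left hpa
    rw [hc₁.ne a₁ ha₁ p (hF₁ hpF) fun h => ha₁F (h ▸ hpF), mul_zero]
  · exact fun h => absurd ha₂ h

/-- At most two simplices share a side. -/
theorem eq_or_eq_of_mem_sides (hn : 0 < n) (h₁ : K₁ ∈ 𝒯.simplices) (h₂ : K₂ ∈ 𝒯.simplices)
    (h₃ : K₃ ∈ 𝒯.simplices) (hne : K₁ ≠ K₂) (hF₁ : F ∈ sides K₁) (hF₂ : F ∈ sides K₂)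
    (hF₃ : F ∈ sides K₃) : K₃ = K₁ ∨ K₃ = K₂ := by
  by_contra! hcon
  obtain ⟨c₁, hc₁⟩ := exists_isBarycentric (𝒯.card_eq _ h₁) (𝒯.indep _ h₁)
  obtain ⟨c₂, hc₂⟩ := exists_isBarycentric (𝒯.card_eq _ h₂) (𝒯.indep _ h₂)
  obtain ⟨c₃, hc₃⟩ := exists_isBarycentric (𝒯.card_eq _ h₃) (𝒯.indep _ h₃)
  obtain ⟨a₁, ha₁, ha₁F, hK₁⟩ := exists_insert_of_mem_sides (𝒯.card_eq _ h₁) hF₁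
  obtain ⟨a₂, ha₂, ha₂F, hK₂⟩ := exists_insert_of_mem_sides (𝒯.card_eq _ h₂) hF₂
  obtain ⟨a₃, ha₃, ha₃F, hK₃⟩ := exists_insert_of_mem_sides (𝒯.card_eq _ h₃) hF₃
  have h12 := coord_apex_neg hn h₁ h₂ hne hF₁ hF₂ hc₁ hc₂ ha₁ hK₁ ha₁F ha₂ ha₂F
  have h13 := coord_apex_neg hn h₁ h₃ hcon.1.symm hF₁ hF₃ hc₁ hc₃ ha₁ hK₁ ha₁F ha₃ ha₃F
  have h23 := coord_apex_neg hn h₂ h₃ hcon.2.symm hF₂ hF₃ hc₂ hc₃ ha₂ hK₂ ha₂F ha₃ ha₃F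
  -- Three simplices cannot lie on pairwise opposite sides of one hyperplane: the negative `c₁ a₁
  -- a₃` would be a product of two negative numbers.
  have := coord_apex_eq_mul (mem_sides.1 hF₁).1 hc₁ hc₂ ha₁ ha₁F ha₂ hK₂ a₃
  have := mul_pos_of_neg_of_neg h23 h12
  linarith

/-- Near the centroid the coordinates of the vertices of `F` stay positive in both simplices. The
sign of the remaining coordinate decides which of the two contains the point, so together they cover
a neighbourhood. -/
theorem centerMass_mem_interior (hn : 0 < n) (h₁ : K₁ ∈ 𝒯.simplices) (h₂ : K₂ ∈ 𝒯.simplices)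
    (hne : K₁ ≠ K₂) (hF₁ : F ∈ sides K₁) (hF₂ : F ∈ sides K₂) :
    F.centerMass (fun _ => (1 : ℝ)) id ∈ interior (closure Ω) := by
  obtain ⟨c₁, hc₁⟩ := exists_isBarycentric (𝒯.card_eq _ h₁) (𝒯.indep _ h₁)
  obtain ⟨c₂, hc₂⟩ := exists_isBarycentric (𝒯.card_eq _ h₂) (𝒯.indep _ h₂)
  obtain ⟨a₁, ha₁, ha₁F, hK₁⟩ := exists_insert_of_mem_sides (𝒯.card_eq _ h₁) hF₁
  obtain ⟨a₂, ha₂, ha₂F, hK₂⟩ := exists_insert_of_mem_sides (𝒯.card_eq _ h₂) hF₂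
  obtain ⟨hFK₁, hFc⟩ := mem_sides.1 hF₁
  obtain ⟨hFK₂, -⟩ := mem_sides.1 hF₂
  have h12 := coord_apex_neg hn h₁ h₂ hne hF₁ hF₂ hc₁ hc₂ ha₁ hK₁ ha₁F ha₂ ha₂F
  set z := F.centerMass (fun _ => (1 : ℝ)) id with hz
  have hev : ∀ {K : Finset (Eucl n)} {c : Eucl n → (Eucl n →ᵃ[ℝ] ℝ)}, IsBarycentric K c →
      F ⊆ K → ∀ᶠ x in nhds z, ∀ p ∈ F, 0 < c p x := by
    intro K c hc hFK
    rw [Filter.eventually_all_finset]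
    intro p hp
    refine (c p).continuous_of_finiteDimensional.tendsto z |>.eventually (lt_mem_nhds ?_)
    rw [hc.apply_centroid hFK hn hFc hp]
    positivity
  have hcov : ∀ {K}, K ∈ 𝒯.simplices → hull K ⊆ closure Ω := fun {K} hK => by
    rw [← 𝒯.cover]
    exact Set.subset_biUnion_of_mem (u := hull) hK
  rw [mem_interior_iff_mem_nhds]
  filter_upwards [hev hc₁ hFK₁, hev hc₂ hFK₂] with x hx₁ hx₂
  rcases le_or_gt 0 (c₁ a₁ x) with hx | hx
  · refine hcov h₁ (hc₁.mem_hull x fun p hp => ?_)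
    rcases hK₁ p hp with rfl | hpF
    · exact hx
    · exact (hx₁ p hpF).le
  · refine hcov h₂ (hc₂.mem_hull x fun p hp => ?_)
    rcases hK₂ p hp with rfl | hpF
    · have := coord_apex_eq_mul hFK₁ hc₁ hc₂ ha₁ ha₁F ha₂ hK₂ x
      by_contra! hneg
      have := mul_pos_of_neg_of_neg hneg h12
      linarith
    · exact (hx₂ p hpF).le

end RegularTriangulation

/-- A Lipschitz domain lies on one side of its boundary. -/
theorem IsLipschitzDomain.notMem_interior_closure (hΩ : IsLipschitzDomain Ω) {x : Eucl n}
    (hx : x ∈ frontier Ω) : x ∉ interior (closure Ω) := by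
  intro hint
  obtain ⟨U, hU, e, he, L, g, hg, hge, hmem⟩ := hΩ.boundary x hx
  have hxΩ : x ∉ Ω := by
    rw [hΩ.isOpen.frontier_eq] at hx
    exact hx.2
  have hgx : inner ℝ e x ≤ g x := by
    by_contra! h
    exact hxΩ ((hmem x (mem_of_mem_nhds hU)).2 h)
  have hN : interior U ∩ interior (closure Ω) ∈ nhds x :=
    (isOpen_interior.inter isOpen_interior).mem_nhds ⟨mem_interior_iff_mem_nhds.2 hU, hint⟩
  -- A small step along `-e` leads strictly below the graph, since `g` is constant in that
  -- direction. A neighbourhood of the new point misses `Ω`, although the point is still in its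
  -- closure.
  have hcont : Continuous fun t : ℝ => x + (-t) • e := by fun_prop
  have hev : ∀ᶠ t in nhds (0 : ℝ), x + (-t) • e ∈ interior U ∩ interior (closure Ω) :=
    hcont.tendsto' 0 x (by simp) |>.eventually hN
  obtain ⟨ε, hε, hball⟩ := Metric.eventually_nhds_iff.1 hev
  have hmem' := hball (y := ε / 2) (by
    rw [Real.dist_0_eq_abs, abs_of_pos (by positivity)]; linarith)
  set y := x + (-(ε / 2)) • e with hy
  have hlt : inner ℝ e y < g y := by
    rw [hy, hge, inner_add_right, inner_smul_right, real_inner_self_eq_norm_sq, he]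
    linarith
  have hW : IsOpen (interior U ∩ {w | inner ℝ e w < g w}) :=
    isOpen_interior.inter (isOpen_lt (by fun_prop) hg.continuous)
  have hycl : y ∈ closure Ω := interior_subset hmem'.2
  obtain ⟨w, ⟨hwU, hw⟩, hwΩ⟩ := mem_closure_iff.1 hycl _ hW ⟨hmem'.1, hlt⟩
  exact lt_asymm ((hmem w (interior_subset hwU)).1 hwΩ) hw

namespace RegularTriangulation

variable {𝒯 : RegularTriangulation Ω} {T K K₁ K₂ F : Finset (Eucl n)}

/-- A side on the boundary belongs to one simplex only. -/
theorem eq_of_mem_sides_of_subset_frontier (hn : 0 < n) (hΩ : IsLipschitzDomain Ω)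
    (h₁ : K₁ ∈ 𝒯.simplices) (h₂ : K₂ ∈ 𝒯.simplices) (hF₁ : F ∈ sides K₁) (hF₂ : F ∈ sides K₂)
    (hF : hull F ⊆ frontier Ω) : K₁ = K₂ := by
  by_contra hne
  exact hΩ.notMem_interior_closure (hF (centerMass_mem_hull hn (mem_sides.1 hF₁).2))
    (centerMass_mem_interior hn h₁ h₂ hne hF₁ hF₂)

/-- This makes the jump seminorm local: jumps are defined with all of `𝒯`, but across these sides
they involve the patch only. -/
theorem mem_patch_of_mem_localSides (hn : 0 < n) (hΩ : IsLipschitzDomain Ω)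
    (hF : F ∈ 𝒯.localSides T) (hK : K ∈ 𝒯.simplices) (hFK : F ∈ sides K) : K ∈ 𝒯.patch T := by
  obtain ⟨⟨K', hK', hFK'⟩, ⟨K₁, h₁, K₂, h₂, hne, hF₁, hF₂⟩ | hfr⟩ := mem_localSides.1 hF
  · rcases eq_or_eq_of_mem_sides hn (mem_patch.1 h₁).1 (mem_patch.1 h₂).1 hK hne hF₁ hF₂ hFK
      with rfl | rfl
    · exact h₁
    · exact h₂
  · rw [eq_of_mem_sides_of_subset_frontier hn hΩ hK (mem_patch.1 hK').1 hFK hFK' hfr]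
    exact hK'

/-- Needed so that the broken norm over a non-refined simplex has a single summand. A vertex of `K`
outside `T` would lie in the hull of the other vertices of `K`. -/
theorem eq_of_hull_subset (hK : K ∈ 𝒯.simplices) (hT : T ∈ 𝒯.simplices) (h : hull K ⊆ hull T) :
    K = T := by
  obtain ⟨c, hc⟩ := exists_isBarycentric (𝒯.card_eq _ hK) (𝒯.indep _ hK)
  have hsub : K ⊆ T := by
    intro p hp
    by_contra hpT
    have hp' : p ∈ convexHull ℝ ((K : Set (Eucl n)) ∩ (T : Set (Eucl n))) := by
      rw [← 𝒯.inter K hK T hT]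
      exact ⟨mem_hull hp, h (mem_hull hp)⟩
    have h0 := hc.eq_zero_of_mem_convexHull Set.inter_subset_left hp (fun h => hpT h.2) hp'
    rw [hc.self p hp] at h0
    exact one_ne_zero h0
  exact Finset.eq_of_subset_of_card_le hsub (by rw [𝒯.card_eq _ hK, 𝒯.card_eq _ hT])

theorem mem_patch_iff_exists_common_vertex (hT : T ∈ 𝒯.simplices) :
    K ∈ 𝒯.patch T ↔ ∃ z ∈ T, K ∈ 𝒯.nodalPatch z := by
  rw [mem_patch]
  constructor
  · rintro ⟨hK, hne⟩
    rw [𝒯.inter T hT K hK, convexHull_nonempty_iff] at hne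
    obtain ⟨z, hzT, hzK⟩ := hne
    exact ⟨z, hzT, mem_nodalPatch.2 ⟨hK, hzK⟩⟩
  · rintro ⟨z, hzT, hzK⟩
    obtain ⟨hK, hz⟩ := mem_nodalPatch.1 hzK
    exact ⟨hK, z, mem_hull hzT, mem_hull hz⟩

theorem self_mem_patch (hT : T ∈ 𝒯.simplices) : T ∈ 𝒯.patch T := by
  obtain ⟨z, hz⟩ : T.Nonempty := Finset.card_pos.1 (by rw [𝒯.card_eq _ hT]; omega)
  exact mem_patch.2 ⟨hT, z, mem_hull hz, mem_hull hz⟩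

theorem mem_patch_comm (hT : T ∈ 𝒯.simplices) (h : K ∈ 𝒯.patch T) : T ∈ 𝒯.patch K := by
  obtain ⟨-, h⟩ := mem_patch.1 h
  exact mem_patch.2 ⟨hT, by rwa [Set.inter_comm]⟩

end RegularTriangulation

end Geometry

/-! ### The overlap constant and the global estimate -/

section Estimate

variable {n m : ℕ} {Ω : Set (Eucl n)}

theorem card_moveSimplices_le (a : Eucl n) (r : ℝ) (S : Finset (Finset (Eucl n))) :
    (moveSimplices a r S).card ≤ S.card := by
  classical
  exact Finset.card_image_le

/-- Simplices that meet have a common vertex, so a patch is covered by the `n + 1` nodal patches of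
`T`, each no larger than some reference patch. -/
theorem overlapConst_lt_top {𝕋 : Set (RegularTriangulation Ω)}
    (hA2 : FinitePatchConfigurations 𝕋) : overlapConst 𝕋 < ⊤ := by
  classical
  obtain ⟨J, C, hC⟩ := hA2
  refine lt_of_le_of_lt (b := (((n + 1) * ∑ j, (C j).card : ℕ) : ℝ≥0∞)) ?_
    (ENNReal.natCast_lt_top _)
  refine iSup₂_le fun 𝒯 h𝒯 => iSup₂_le fun T hT => ?_
  norm_cast
  have hsub : 𝒯.patch T ⊆ T.biUnion 𝒯.nodalPatch := fun K hK => by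
    obtain ⟨z, hz, hzK⟩ := (RegularTriangulation.mem_patch_iff_exists_common_vertex hT).1 hK
    exact Finset.mem_biUnion.2 ⟨z, hz, hzK⟩
  rw [← 𝒯.card_eq T hT]
  refine (Finset.card_le_card hsub).trans (Finset.card_biUnion_le_card_mul _ _ _ fun z hz => ?_)
  obtain ⟨j, h, -, hj⟩ := hC 𝒯 h𝒯 T hT z hz
  rw [hj]
  exact (card_moveSimplices_le _ _ _).trans
    (Finset.single_le_sum (f := fun j => (C j).card) (fun _ _ => Nat.zero_le _) (Finset.mem_univ j))

theorem card_patch_le_overlapConst {𝕋 : Set (RegularTriangulation Ω)} {𝒯 : RegularTriangulation Ω}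
    (h𝒯 : 𝒯 ∈ 𝕋) {T : Finset (Eucl n)} (hT : T ∈ 𝒯.simplices) :
    ((𝒯.patch T).card : ℝ≥0∞) ≤ overlapConst 𝕋 :=
  le_iSup₂_of_le 𝒯 h𝒯 (le_iSup₂_of_le T hT le_rfl)

theorem meshSize_mono {F K : Finset (Eucl n)} (h : F ⊆ K) : meshSize F ≤ meshSize K :=
  ENNReal.ofReal_le_ofReal (Metric.diam_mono (convexHull_mono (by exact_mod_cast h))
    (isCompact_hull K).isBounded)

theorem plusSimplex_mem_sidePatch {𝒯 : RegularTriangulation Ω} {F : Finset (Eucl n)}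
    (h : (𝒯.sidePatch F).Nonempty) : plusSimplex 𝒯 F ∈ 𝒯.sidePatch F := by
  rw [plusSimplex, dif_pos h]
  exact h.choose_spec

theorem derivJump_congr (m : ℕ) {𝒯 : RegularTriangulation Ω} {F : Finset (Eucl n)}
    (h : (𝒯.sidePatch F).Nonempty) {v w : PiecewiseFun n}
    (hvw : ∀ K ∈ 𝒯.sidePatch F, v K = w K) (x : Eucl n) :
    derivJump m 𝒯 F v x = derivJump m 𝒯 F w x := by
  classical
  simp only [derivJump]
  rw [hvw _ (plusSimplex_mem_sidePatch h)]
  congr 1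
  refine Finset.sum_congr rfl fun K hK => ?_
  rw [hvw K (Finset.mem_of_mem_erase hK)]

theorem sidePatch_nonempty_of_mem_localSides {𝒯 : RegularTriangulation Ω}
    {T F : Finset (Eucl n)} (hF : F ∈ 𝒯.localSides T) : (𝒯.sidePatch F).Nonempty := by
  obtain ⟨⟨K, hK, hFK⟩, -⟩ := RegularTriangulation.mem_localSides.1 hF
  exact ⟨K, RegularTriangulation.mem_sidePatch.2 ⟨(RegularTriangulation.mem_patch.1 hK).1, hFK⟩⟩

theorem tangentialJumpNorm_restrictTo [NeZero m] (hn : 0 < n) (hΩ : IsLipschitzDomain Ω)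
    {𝒯 : RegularTriangulation Ω} {T F : Finset (Eucl n)} (hF : F ∈ 𝒯.localSides T)
    (u : PiecewiseFun n) :
    tangentialJumpNorm m 𝒯 F (restrictTo (𝒯.patch T) u) = tangentialJumpNorm m 𝒯 F u := by
  unfold tangentialJumpNorm
  congr 1
  funext x
  rw [derivJump_congr m (sidePatch_nonempty_of_mem_localSides hF) (w := u)]
  intro K hK
  obtain ⟨hK, hFK⟩ := RegularTriangulation.mem_sidePatch.1 hK
  simp [restrictTo, RegularTriangulation.mem_patch_of_mem_localSides hn hΩ hF hK hFK]

/-- Each local side is charged to the simplices of the patch that contain it, of which there is at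
least one, and `h_F ≤ h_K` for each of them. -/
theorem jumpSeminorm_restrictTo_sq_le [NeZero m] (hn : 0 < n) (hΩ : IsLipschitzDomain Ω)
    (𝒯 : RegularTriangulation Ω) (T : Finset (Eucl n)) (u : PiecewiseFun n) :
    jumpSeminorm m 𝒯 T (restrictTo (𝒯.patch T) u) ^ 2 ≤
      ∑ K ∈ 𝒯.patch T, meshSize K * ∑ F ∈ sides K, tangentialJumpNorm m 𝒯 F u ^ 2 := by
  classical
  rw [jumpSeminorm, rpow_half_sq]
  calc ∑ F ∈ 𝒯.localSides T,
        meshSize F * tangentialJumpNorm m 𝒯 F (restrictTo (𝒯.patch T) u) ^ 2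
      = ∑ F ∈ 𝒯.localSides T, meshSize F * tangentialJumpNorm m 𝒯 F u ^ 2 :=
        Finset.sum_congr rfl fun F hF => by rw [tangentialJumpNorm_restrictTo hn hΩ hF]
    _ ≤ ∑ F ∈ 𝒯.localSides T, ∑ K ∈ (𝒯.patch T).filter (F ∈ sides ·),
        meshSize K * tangentialJumpNorm m 𝒯 F u ^ 2 := by
        refine Finset.sum_le_sum fun F hF => ?_
        obtain ⟨⟨K, hK, hFK⟩, -⟩ := RegularTriangulation.mem_localSides.1 hF
        refine le_trans ?_ (Finset.single_le_sum
          (f := fun K => meshSize K * tangentialJumpNorm m 𝒯 F u ^ 2) (fun _ _ => zero_le)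
          (Finset.mem_filter.2 ⟨hK, hFK⟩))
        gcongr
        exact meshSize_mono (mem_sides.1 hFK).1
    _ = ∑ K ∈ 𝒯.patch T, ∑ F ∈ (𝒯.localSides T).filter (· ∈ sides K),
        meshSize K * tangentialJumpNorm m 𝒯 F u ^ 2 :=
        Finset.sum_comm' fun F K => by simp only [Finset.mem_filter]; tauto
    _ ≤ _ := by
        refine Finset.sum_le_sum fun K _ => ?_
        rw [Finset.mul_sum]
        exact Finset.sum_le_sum_of_subset fun F hF => (Finset.mem_filter.1 hF).2

theorem brokenNorm_eq_zero {𝒯' : RegularTriangulation Ω} {T : Finset (Eucl n)}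
    (hT : T ∈ 𝒯'.simplices) {v w : PiecewiseFun n} (h : ∀ x ∈ hull T, v T x - w T x = 0) :
    brokenNorm m 𝒯' T v w = 0 := by
  classical
  have h0 : eLpNorm (fun x => derivTensor m (v T) x - derivTensor m (w T) x) 2
      (volume.restrict (hull T)) = 0 := by
    rw [eLpNorm_congr_ae (g := 0), eLpNorm_zero]
    rw [← restrict_interior_hull]
    refine (ae_restrict_iff' isOpen_interior.measurableSet).2
      (Filter.Eventually.of_forall fun x hx => ?_)
    have hev : v T =ᶠ[nhds x] w T := by
      filter_upwards [isOpen_interior.mem_nhds hx] with y hy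
      exact sub_eq_zero.1 (h y (interior_subset hy))
    have : iteratedFDeriv ℝ m (v T) x = iteratedFDeriv ℝ m (w T) x :=
      (hev.iteratedFDeriv ℝ m).eq_of_nhds
    simp [derivTensor, this]
  rw [brokenNorm, Finset.sum_eq_zero, ENNReal.zero_rpow_of_pos (by norm_num)]
  intro K hK
  obtain ⟨hK, hsub⟩ := Finset.mem_filter.1 hK
  rw [RegularTriangulation.eq_of_hull_subset hK hT hsub, h0]
  simp

/-- Interchange the sums: by symmetry of the neighbour relation, `K` is counted once for each
refined simplex in its own patch. -/
theorem sum_refined_patch_le {𝕋 : Set (RegularTriangulation Ω)} {𝒯 𝒯' : RegularTriangulation Ω}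
    (h𝒯 : 𝒯 ∈ 𝕋) (g : Finset (Eucl n) → ℝ≥0∞) :
    ∑ T ∈ 𝒯.refined 𝒯', ∑ K ∈ 𝒯.patch T, g K ≤
      overlapConst 𝕋 * ∑ K ∈ 𝒯.refinedLayer 𝒯', g K := by
  classical
  have hcomm : ∑ T ∈ 𝒯.refined 𝒯', ∑ K ∈ 𝒯.patch T, g K =
      ∑ K ∈ 𝒯.refinedLayer 𝒯', ∑ T ∈ (𝒯.refined 𝒯').filter (K ∈ 𝒯.patch ·), g K := by
    refine Finset.sum_comm' fun T K => ?_
    simp only [Finset.mem_filter]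
    refine ⟨fun h => ⟨h, ?_⟩, fun h => h.1⟩
    obtain ⟨hK, hne⟩ := RegularTriangulation.mem_patch.1 h.2
    exact RegularTriangulation.mem_refinedLayer.2 ⟨hK, T, h.1, by rwa [Set.inter_comm]⟩
  rw [hcomm, Finset.mul_sum]
  refine Finset.sum_le_sum fun K hK => ?_
  have hK := (RegularTriangulation.mem_refinedLayer.1 hK).1
  rw [Finset.sum_const, nsmul_eq_mul]
  gcongr
  refine le_trans ?_ (card_patch_le_overlapConst h𝒯 hK)
  norm_cast
  refine Finset.card_le_card fun T hT => ?_
  obtain ⟨hT, hTK⟩ := Finset.mem_filter.1 hT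
  exact RegularTriangulation.mem_patch_comm (RegularTriangulation.mem_refined.1 hT).1 hTK

theorem discreteNorm_sq_le [NeZero m] (hn : 0 < n) (hΩ : IsLipschitzDomain Ω)
    {𝕋 : Set (RegularTriangulation Ω)}
    {V : RegularTriangulation Ω → Submodule ℝ (PiecewiseFun n)}
    (J₂ : ∀ 𝒯 : RegularTriangulation Ω, V 𝒯 →ₗ[ℝ] SobolevZero m Ω) (J : LocalCompanion m V)
    {𝒯 : RegularTriangulation Ω} (h𝒯 : 𝒯 ∈ 𝕋)
    (hlocal : ∀ T ∈ 𝒯.simplices, ∀ v : V 𝒯,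
      sobolevFn (J₂ 𝒯 v) =ᵐ[volume.restrict (hull T)] sobolevFn (J 𝒯 T (toLocal V 𝒯 T v)))
    (hbound : ∀ T ∈ 𝒯.simplices, ∀ w : localSpace V 𝒯 T,
      errorNorm T (J 𝒯 T w) w ≤ companionConst J 𝒯 T * jumpSeminorm m 𝒯 T w)
    {𝒯' : RegularTriangulation Ω}
    (I : V 𝒯' → V 𝒯) (I' : SobolevZero m Ω → V 𝒯') (Λ₅ : ℝ≥0) (u : V 𝒯)
    (hC3 : ∀ T ∈ 𝒯.simplices, T ∈ 𝒯'.simplices → ∀ v : V 𝒯', ∀ x ∈ hull T,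
      (v : PiecewiseFun n) T x - (I v : PiecewiseFun n) T x = 0)
    (hC4 : I (I' (J₂ 𝒯 u)) = u)
    (hC5 : ∀ T ∈ 𝒯.simplices, ∀ (v : SobolevZero m Ω) (w : V 𝒯),
      brokenNorm m 𝒯' T (I' v) w ≤ Λ₅ * errorNorm T v w) :
    discreteNorm m 𝒯 𝒯' (I' (J₂ 𝒯 u)) u ^ 2 ≤
      (Λ₅ * uniformCompanionConst J 𝕋 * overlapConst 𝕋 ^ (1 / 2 : ℝ)) ^ 2 *
        ∑ T ∈ 𝒯.refinedLayer 𝒯', meshSize T *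
          ∑ F ∈ sides T, tangentialJumpNorm m 𝒯 F u ^ 2 := by
  classical
  rw [discreteNorm, rpow_half_sq, mul_pow, rpow_half_sq]
  have hsub : 𝒯.refined 𝒯' ⊆ 𝒯.simplices := fun T hT =>
    (RegularTriangulation.mem_refined.1 hT).1
  -- The sum reduces to refined simplices. On the others (C3) and (C4) give `û* = u`, which is the
  -- second goal.
  rw [← Finset.sum_subset hsub]
  · calc ∑ T ∈ 𝒯.refined 𝒯', brokenNorm m 𝒯' T (I' (J₂ 𝒯 u)) u ^ 2
        ≤ ∑ T ∈ 𝒯.refined 𝒯', (Λ₅ * uniformCompanionConst J 𝕋) ^ 2 *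
          ∑ K ∈ 𝒯.patch T, meshSize K * ∑ F ∈ sides K, tangentialJumpNorm m 𝒯 F u ^ 2 := by
          refine Finset.sum_le_sum fun T hT => ?_
          have hT := hsub hT
          have hle : brokenNorm m 𝒯' T (I' (J₂ 𝒯 u)) u ≤ Λ₅ * uniformCompanionConst J 𝕋 *
              jumpSeminorm m 𝒯 T (restrictTo (𝒯.patch T) u) := by
            refine (hC5 T hT _ u).trans ?_
            rw [mul_assoc]
            gcongr
            have herr : errorNorm T (J₂ 𝒯 u) u =
                errorNorm T (J 𝒯 T (toLocal V 𝒯 T u)) (toLocal V 𝒯 T u) :=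
              errorNorm_congr T (hlocal T hT u)
                (by simp [toLocal, restrictTo, RegularTriangulation.self_mem_patch hT])
            rw [herr]
            refine (hbound T hT _).trans ?_
            gcongr
            · exact le_iSup₂_of_le 𝒯 h𝒯 (le_iSup₂_of_le T hT le_rfl)
            · exact le_rfl
          calc _ ≤ _ := pow_le_pow_left' hle 2
            _ = _ := mul_pow _ _ 2
            _ ≤ _ := by
              gcongr
              exact jumpSeminorm_restrictTo_sq_le hn hΩ 𝒯 T u
      _ ≤ _ := by
          rw [← Finset.mul_sum, mul_assoc]
          gcongr
          exact sum_refined_patch_le h𝒯 _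
  · intro T hT hTr
    have hT' : T ∈ 𝒯'.simplices := by
      by_contra h
      exact hTr (RegularTriangulation.mem_refined.2 ⟨hT, h⟩)
    have := hC3 T hT hT' (I' (J₂ 𝒯 u))
    rw [hC4] at this
    rw [brokenNorm_eq_zero hT' this]
    simp

end Estimate

/-! ### Invariance under homotheties -/

section Scaling

variable {n m : ℕ} {Ω : Set (Eucl n)} {a : Eucl n} {r : ℝ}

/-- The homothety `x ↦ a + r x` as an affine map. -/
noncomputable def homothetyAffine (a : Eucl n) (r : ℝ) : Eucl n →ᵃ[ℝ] Eucl n where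
  toFun := homothetyMap a r
  linear := r • LinearMap.id
  map_vadd' x v := by
    simp only [homothetyMap, vadd_eq_add, smul_add, LinearMap.smul_apply, LinearMap.id_apply]
    abel

theorem homothetyMap_injective (a : Eucl n) (hr : r ≠ 0) :
    Function.Injective (homothetyMap a r) := (homothetyHomeomorph a hr).injective

theorem coe_moveSimplex (a : Eucl n) (r : ℝ) (T : Finset (Eucl n)) :
    (moveSimplex a r T : Set (Eucl n)) = homothetyMap a r '' T := by
  classical
  simp [moveSimplex]

theorem moveSimplex_injective (a : Eucl n) (hr : r ≠ 0) :
    Function.Injective (moveSimplex a r : Finset (Eucl n) → _) := by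
  classical
  exact Finset.image_injective (homothetyMap_injective a hr)

theorem card_moveSimplex (a : Eucl n) (hr : r ≠ 0) (T : Finset (Eucl n)) :
    (moveSimplex a r T).card = T.card := by
  classical
  exact Finset.card_image_of_injective _ (homothetyMap_injective a hr)

theorem moveSimplex_subset_iff (a : Eucl n) (hr : r ≠ 0) {F T : Finset (Eucl n)} :
    moveSimplex a r F ⊆ moveSimplex a r T ↔ F ⊆ T := by
  classical
  exact Finset.image_subset_image_iff (homothetyMap_injective a hr)

theorem moveSimplex_mem_sides_iff (a : Eucl n) (hr : r ≠ 0) {F T : Finset (Eucl n)} :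
    moveSimplex a r F ∈ sides (moveSimplex a r T) ↔ F ∈ sides T := by
  rw [mem_sides, mem_sides, moveSimplex_subset_iff a hr, card_moveSimplex a hr]

theorem mem_moveSimplices {S : Finset (Finset (Eucl n))} {K : Finset (Eucl n)} :
    K ∈ moveSimplices a r S ↔ ∃ L ∈ S, moveSimplex a r L = K := by
  classical
  simp [moveSimplices]

theorem moveSimplex_moveSimplex (a b : Eucl n) (r s : ℝ) (T : Finset (Eucl n)) :
    moveSimplex a r (moveSimplex b s T) = moveSimplex (a + r • b) (r * s) T := by
  classical
  simp only [moveSimplex, Finset.image_image]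
  congr 1
  funext x
  simp [homothetyMap, smul_smul, add_assoc]

theorem moveSimplices_moveSimplices (a b : Eucl n) (r s : ℝ) (S : Finset (Finset (Eucl n))) :
    moveSimplices a r (moveSimplices b s S) = moveSimplices (a + r • b) (r * s) S := by
  classical
  simp only [moveSimplices, Finset.image_image]
  congr 1
  funext T
  exact moveSimplex_moveSimplex a b r s T

theorem moveSimplex_zero_one (T : Finset (Eucl n)) : moveSimplex 0 1 T = T := by
  classical
  have : homothetyMap (0 : Eucl n) 1 = id := by funext x; simp [homothetyMap]
  simp [moveSimplex, this]

theorem moveSimplices_zero_one (S : Finset (Finset (Eucl n))) : moveSimplices 0 1 S = S := by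
  classical
  have : (moveSimplex (0 : Eucl n) 1 : Finset (Eucl n) → _) = id := by
    funext x; exact moveSimplex_zero_one x
  simp [moveSimplices, this]

theorem hull_moveSimplex (a : Eucl n) (r : ℝ) (T : Finset (Eucl n)) :
    hull (moveSimplex a r T) = homothetyMap a r '' hull T := by
  rw [hull, hull, coe_moveSimplex]
  exact ((homothetyAffine a r).image_convexHull _).symm

open scoped Pointwise in
theorem diam_image_homothetyMap (a : Eucl n) (hr : 0 < r) (s : Set (Eucl n)) :
    Metric.diam (homothetyMap a r '' s) = r * Metric.diam s := by
  have h : homothetyMap a r '' s = a +ᵥ (r • s) := by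
    ext z
    simp [homothetyMap, Set.mem_vadd_set, Set.mem_smul_set]
  rw [h, diam_vadd, diam_smul₀, Real.norm_of_nonneg hr.le]

theorem meshSize_moveSimplex (a : Eucl n) (hr : 0 < r) (T : Finset (Eucl n)) :
    meshSize (moveSimplex a r T) = ENNReal.ofReal r * meshSize T := by
  rw [meshSize, hull_moveSimplex, diam_image_homothetyMap a hr, ENNReal.ofReal_mul hr.le, meshSize]

theorem vectorSpan_moveSimplex (a : Eucl n) (hr : r ≠ 0) (F : Finset (Eucl n)) :
    vectorSpan ℝ (moveSimplex a r F : Set (Eucl n)) = vectorSpan ℝ (F : Set (Eucl n)) := by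
  rw [coe_moveSimplex]
  have h := (homothetyAffine a r).map_vectorSpan (s := (F : Set (Eucl n)))
  refine h.symm.trans ?_
  ext v
  constructor
  · rintro ⟨w, hw, rfl⟩
    exact Submodule.smul_mem _ r hw
  · intro hv
    exact ⟨r⁻¹ • v, Submodule.smul_mem _ _ hv, by simp [homothetyAffine, smul_smul, hr]⟩

theorem tangentialPart_moveSimplex [NeZero m] (a : Eucl n) (hr : r ≠ 0) (F : Finset (Eucl n))
    (A : DTensor n m) : tangentialPart (moveSimplex a r F) A = tangentialPart F A := by
  simp only [tangentialPart, vectorSpan_moveSimplex a hr]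

theorem derivTensor_comp_homothetyMap (i : ℕ) {f : Eucl n → ℝ} (hf : ContDiff ℝ ∞ f) (a : Eucl n)
    (r : ℝ) (x : Eucl n) : derivTensor i (fun y => f (homothetyMap a r y)) x =
      r ^ i • derivTensor i f (homothetyMap a r x) := by
  induction i generalizing x with
  | zero => ext α; simp [derivTensor]
  | succ i ih =>
    ext α
    have hg : ContDiff ℝ ∞ (fun y => derivTensor i f y (Fin.tail α)) :=
      contDiff_euclidean.1 (contDiff_derivTensor i hf) _
    have hg' : ContDiff ℝ ∞ fun y => derivTensor i f (homothetyMap a r y) (Fin.tail α) :=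
      hg.comp (contDiff_homothetyMap a r)
    rw [derivTensor_succ_apply i (f := fun y => f (homothetyMap a r y))
      (hf.comp (contDiff_homothetyMap a r))]
    simp only [ih, PiLp.smul_apply, smul_eq_mul]
    rw [fderiv_const_mul (hg'.differentiable (by simp)).differentiableAt,
      _root_.smul_apply,
      fderiv_comp_homothetyMap (hg.differentiable (by simp)) a r,
      derivTensor_succ_apply i hf, smul_eq_mul]
    ring

open scoped Pointwise in
theorem map_homothetyMap_euclideanHausdorffMeasure (d : ℕ) (a : Eucl n) (hr : 0 < r) :
    (μHE[d] : Measure (Eucl n)).map (homothetyMap a r) = (ENNReal.ofReal r ^ d)⁻¹ • μHE[d] := by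
  ext s hs
  rw [Measure.map_apply (continuous_homothetyMap a r).measurable hs, Measure.smul_apply,
    smul_eq_mul]
  have hpre : homothetyMap a r ⁻¹' s = r⁻¹ • ((-a) +ᵥ s) := by
    ext x
    rw [Set.mem_inv_smul_set_iff₀ hr.ne', Set.mem_vadd_set_iff_neg_vadd_mem]
    simp [homothetyMap]
  rw [hpre, Measure.euclideanHausdorffMeasure_smul₀ d (inv_ne_zero hr.ne'), measure_vadd,
    ENNReal.smul_def, smul_eq_mul]
  congr 1
  rw [ENNReal.coe_pow, nnnorm_inv, ENNReal.coe_inv (by simpa using hr.ne'), ENNReal.inv_pow]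
  congr 2
  rw [← ENNReal.ofReal_coe_nnreal, coe_nnnorm, Real.norm_of_nonneg hr.le]

/-- One transformation rule for surface terms (`d = n - 1`) and volume terms (`d = n`), with the
power of `r` multiplied out to avoid division. -/
theorem eLpNorm_comp_homothetyMap_sq {E : Type*} [NormedAddCommGroup E] (d : ℕ) (a : Eucl n)
    (hr : 0 < r) (f : Eucl n → E) (s : Set (Eucl n)) :
    eLpNorm (fun x => f (homothetyMap a r x)) 2 (μHE[d].restrict s) ^ 2 * ENNReal.ofReal r ^ d =
      eLpNorm f 2 (μHE[d].restrict (homothetyMap a r '' s)) ^ 2 := by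
  have hemb : MeasurableEmbedding (homothetyMap a r) :=
    (homothetyHomeomorph a hr.ne').measurableEmbedding
  have hR0 : ENNReal.ofReal r ^ d ≠ 0 := pow_ne_zero _ (by simpa using hr)
  have hRt : ENNReal.ofReal r ^ d ≠ ⊤ := ENNReal.pow_ne_top ENNReal.ofReal_ne_top
  have h1 : eLpNorm (fun x => f (homothetyMap a r x)) 2 (μHE[d].restrict s) =
      eLpNorm f 2 ((μHE[d].restrict s).map (homothetyMap a r)) :=
    (hemb.eLpNorm_map_measure).symm
  have h2 : ((μHE[d] : Measure (Eucl n)).restrict s).map (homothetyMap a r) =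
      (ENNReal.ofReal r ^ d)⁻¹ • (μHE[d].restrict (homothetyMap a r '' s)) := by
    rw [← Measure.restrict_smul, ← map_homothetyMap_euclideanHausdorffMeasure d a hr,
      hemb.restrict_map, Set.preimage_image_eq s hemb.injective]
  rw [h1, h2, eLpNorm_smul_measure_of_ne_top (by norm_num), smul_eq_mul, mul_pow]
  have h3 : (((ENNReal.ofReal r ^ d)⁻¹) ^ (1 / (2 : ℝ≥0∞)).toReal) ^ 2 =
      (ENNReal.ofReal r ^ d)⁻¹ := by
    rw [show (1 / (2 : ℝ≥0∞)).toReal = (1 / 2 : ℝ) by simp]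
    exact rpow_half_sq _
  rw [h3, mul_comm, ← mul_assoc, ENNReal.mul_inv_cancel hR0 hRt, one_mul]

end Scaling

/-! ### Scaling of jumps, errors and local constants. -/

section Invariance

variable {n m : ℕ} {Ω : Set (Eucl n)} {a : Eucl n} {r : ℝ}

/-- Up to the sign, the jump does not depend on the choice of the simplex `T₊`. -/
theorem derivJump_eq_or_neg (hn : 0 < n) (m : ℕ) {𝒯 : RegularTriangulation Ω}
    {F P : Finset (Eucl n)} (hP : P ∈ 𝒯.sidePatch F) (w : PiecewiseFun n)
    (Q : Finset (Finset (Eucl n))) (hQ : ∀ K, K ∈ Q ↔ K ∈ 𝒯.sidePatch F ∧ K ≠ P) :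
    (∀ x, derivJump m 𝒯 F w x = derivTensor m (w P) x - ∑ K ∈ Q, derivTensor m (w K) x) ∨
      ∀ x, derivJump m 𝒯 F w x = -(derivTensor m (w P) x - ∑ K ∈ Q, derivTensor m (w K) x) := by
  classical
  have hplus := plusSimplex_mem_sidePatch ⟨P, hP⟩
  by_cases h : plusSimplex 𝒯 F = P
  · left
    intro x
    have : (𝒯.sidePatch F).erase (plusSimplex 𝒯 F) = Q := by
      ext K
      rw [hQ, Finset.mem_erase, h, and_comm]
    simp only [derivJump]
    rw [← this, h]
  -- If the chosen `T₊` differs from `P`, these are the only two simplices at `F`, and exchanging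
  -- them reverses the sign.
  · right
    intro x
    obtain ⟨hP1, hP2⟩ := RegularTriangulation.mem_sidePatch.1 hP
    obtain ⟨hR1, hR2⟩ := RegularTriangulation.mem_sidePatch.1 hplus
    have hall : ∀ K ∈ 𝒯.sidePatch F, K = plusSimplex 𝒯 F ∨ K = P := fun K hK => by
      obtain ⟨hK1, hK2⟩ := RegularTriangulation.mem_sidePatch.1 hK
      exact RegularTriangulation.eq_or_eq_of_mem_sides hn hR1 hP1 hK1 h hR2 hP2 hK2
    have e1 : (𝒯.sidePatch F).erase (plusSimplex 𝒯 F) = {P} := by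
      ext K
      rw [Finset.mem_erase, Finset.mem_singleton]
      refine ⟨fun hK => (hall K hK.2).resolve_left hK.1, ?_⟩
      rintro rfl
      exact ⟨Ne.symm h, hP⟩
    have e2 : Q = {plusSimplex 𝒯 F} := by
      ext K
      rw [hQ, Finset.mem_singleton]
      refine ⟨fun hK => (hall K hK.1).resolve_right hK.2, ?_⟩
      rintro rfl
      exact ⟨hplus, h⟩
    have e3 : derivJump m 𝒯 F w x = derivTensor m (w (plusSimplex 𝒯 F)) x -
        ∑ K ∈ (𝒯.sidePatch F).erase (plusSimplex 𝒯 F), derivTensor m (w K) x := by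
      simp only [derivJump]
    rw [e3, e1, e2, Finset.sum_singleton, Finset.sum_singleton, neg_sub]

/-- The homothety matches patches, not whole triangulations. This is enough because all simplices at
a local side belong to the patch. -/
theorem sidePatch_moveSimplex (hn : 0 < n) (hΩ : IsLipschitzDomain Ω)
    {𝒯 𝒯' : RegularTriangulation Ω} {T T' F : Finset (Eucl n)}
    (hconf : SameConfiguration a r 𝒯 T 𝒯' T') (hF : F ∈ 𝒯.localSides T) :
    𝒯'.sidePatch (moveSimplex a r F) = moveSimplices a r (𝒯.sidePatch F) := by
  have hr := hconf.pos.ne'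
  have hF' : moveSimplex a r F ∈ 𝒯'.localSides T' := by
    rw [← hconf.sides]
    exact mem_moveSimplices.2 ⟨F, hF, rfl⟩
  ext K'
  rw [mem_moveSimplices]
  constructor
  · intro hK'
    obtain ⟨h1, h2⟩ := RegularTriangulation.mem_sidePatch.1 hK'
    have h3 := RegularTriangulation.mem_patch_of_mem_localSides hn hΩ hF' h1 h2
    rw [← hconf.patch] at h3
    obtain ⟨K, hK, rfl⟩ := mem_moveSimplices.1 h3
    exact ⟨K, RegularTriangulation.mem_sidePatch.2 ⟨(RegularTriangulation.mem_patch.1 hK).1,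
      (moveSimplex_mem_sides_iff a hr).1 h2⟩, rfl⟩
  · rintro ⟨K, hK, rfl⟩
    obtain ⟨h1, h2⟩ := RegularTriangulation.mem_sidePatch.1 hK
    have h3 := RegularTriangulation.mem_patch_of_mem_localSides hn hΩ hF h1 h2
    have h4 : moveSimplex a r K ∈ 𝒯'.patch T' := by
      rw [← hconf.patch]
      exact mem_moveSimplices.2 ⟨K, h3, rfl⟩
    exact RegularTriangulation.mem_sidePatch.2 ⟨(RegularTriangulation.mem_patch.1 h4).1,
      (moveSimplex_mem_sides_iff a hr).2 h2⟩

/-- The chain rule gives `r^m`. The sign of `c` is left open because the arbitrary choices of `T₊`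
in the two triangulations need not correspond. -/
theorem derivJump_pullback (hn : 0 < n) (hΩ : IsLipschitzDomain Ω)
    {𝒯 𝒯' : RegularTriangulation Ω} {T T' F : Finset (Eucl n)}
    (hconf : SameConfiguration a r 𝒯 T 𝒯' T') (hF : F ∈ 𝒯.localSides T)
    {w : PiecewiseFun n} (hw : ∀ K, ContDiff ℝ ∞ (w K)) :
    ∃ c : ℝ, |c| = r ^ m ∧ ∀ x, derivJump m 𝒯 F (pullback a r w) x =
      c • derivJump m 𝒯' (moveSimplex a r F) w (homothetyMap a r x) := by
  classical
  have hr := hconf.pos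
  have hsp := sidePatch_moveSimplex hn hΩ hconf hF
  have hP := plusSimplex_mem_sidePatch (sidePatch_nonempty_of_mem_localSides hF)
  set P := plusSimplex 𝒯 F with hPdef
  have hP' : moveSimplex a r P ∈ 𝒯'.sidePatch (moveSimplex a r F) := by
    rw [hsp]
    exact mem_moveSimplices.2 ⟨P, hP, rfl⟩
  have hinj := moveSimplex_injective a hr.ne'
  have hQ : ∀ K, K ∈ ((𝒯.sidePatch F).erase P).image (moveSimplex a r) ↔
      K ∈ 𝒯'.sidePatch (moveSimplex a r F) ∧ K ≠ moveSimplex a r P := by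
    intro K
    rw [hsp, mem_moveSimplices, Finset.mem_image]
    constructor
    · rintro ⟨L, hL, rfl⟩
      obtain ⟨hL1, hL2⟩ := Finset.mem_erase.1 hL
      exact ⟨⟨L, hL2, rfl⟩, fun h => hL1 (hinj h)⟩
    · rintro ⟨⟨L, hL, rfl⟩, hne⟩
      exact ⟨L, Finset.mem_erase.2 ⟨fun h => hne (by rw [h]), hL⟩, rfl⟩
  have hjump : ∀ x, derivJump m 𝒯 F (pullback a r w) x =
      r ^ m • (derivTensor m (w (moveSimplex a r P)) (homothetyMap a r x) -
        ∑ K ∈ ((𝒯.sidePatch F).erase P).image (moveSimplex a r),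
          derivTensor m (w K) (homothetyMap a r x)) := by
    intro x
    have hpb : ∀ K, derivTensor m (pullback a r w K) x =
        r ^ m • derivTensor m (w (moveSimplex a r K)) (homothetyMap a r x) := fun K =>
      derivTensor_comp_homothetyMap m (hw _) a r x
    rw [Finset.sum_image hinj.injOn, smul_sub, Finset.smul_sum]
    simp only [derivJump, hpb]
    rfl
  rcases derivJump_eq_or_neg hn m hP' w _ hQ with h | h
  · exact ⟨r ^ m, abs_of_pos (by positivity), fun x => by rw [hjump, h]⟩
  · exact ⟨-r ^ m, by rw [abs_neg, abs_of_pos (by positivity)], fun x => by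
      rw [hjump, h, neg_smul, smul_neg, neg_neg]⟩

theorem tangentialJumpNorm_pullback_sq [NeZero m] (hn : 0 < n) (hΩ : IsLipschitzDomain Ω)
    {𝒯 𝒯' : RegularTriangulation Ω} {T T' F : Finset (Eucl n)}
    (hconf : SameConfiguration a r 𝒯 T 𝒯' T') (hF : F ∈ 𝒯.localSides T)
    {w : PiecewiseFun n} (hw : ∀ K, ContDiff ℝ ∞ (w K)) :
    tangentialJumpNorm m 𝒯 F (pullback a r w) ^ 2 * ENNReal.ofReal r ^ (n - 1) =
      (ENNReal.ofReal r ^ m) ^ 2 * tangentialJumpNorm m 𝒯' (moveSimplex a r F) w ^ 2 := by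
  have hr := hconf.pos
  obtain ⟨c, hc, hcx⟩ := derivJump_pullback (m := m) hn hΩ hconf hF hw
  have hfun : (fun x => tangentialPart F (derivJump m 𝒯 F (pullback a r w) x)) =
      c • fun x => (fun y => tangentialPart (moveSimplex a r F)
        (derivJump m 𝒯' (moveSimplex a r F) w y)) (homothetyMap a r x) := by
    funext x
    simp only [Pi.smul_apply, hcx, tangentialPart_moveSimplex a hr.ne']
    exact map_smul (tangentialPartCLM F) c _
  have hcn : ‖c‖ₑ = ENNReal.ofReal r ^ m := by
    rw [← ofReal_norm, Real.norm_eq_abs, hc, ENNReal.ofReal_pow hr.le]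
  rw [tangentialJumpNorm, hfun, eLpNorm_const_smul, hcn, mul_pow, mul_assoc,
    eLpNorm_comp_homothetyMap_sq (n - 1) a hr (fun y => tangentialPart (moveSimplex a r F)
      (derivJump m 𝒯' (moveSimplex a r F) w y)), tangentialJumpNorm, hull_moveSimplex]

/-- The weight `h_F` supplies the one power of `r` by which surface measure falls short of volume,
so the exponents agree with those of `errorNorm_pullback_sq`. -/
theorem jumpSeminorm_pullback_sq [NeZero m] (hn : 0 < n) (hΩ : IsLipschitzDomain Ω)
    {𝒯 𝒯' : RegularTriangulation Ω} {T T' : Finset (Eucl n)}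
    (hconf : SameConfiguration a r 𝒯 T 𝒯' T')
    {w : PiecewiseFun n} (hw : ∀ K, ContDiff ℝ ∞ (w K)) :
    jumpSeminorm m 𝒯 T (pullback a r w) ^ 2 * ENNReal.ofReal r ^ n =
      (ENNReal.ofReal r ^ m) ^ 2 * jumpSeminorm m 𝒯' T' w ^ 2 := by
  classical
  have hr := hconf.pos
  have hs : 𝒯'.localSides T' = (𝒯.localSides T).image (moveSimplex a r) := by
    rw [← hconf.sides]
    ext F
    rw [mem_moveSimplices, Finset.mem_image]
  rw [jumpSeminorm, jumpSeminorm, rpow_half_sq, rpow_half_sq, hs,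
    Finset.sum_image (moveSimplex_injective a hr.ne').injOn, Finset.sum_mul, Finset.mul_sum]
  refine Finset.sum_congr rfl fun F hF => ?_
  have h := tangentialJumpNorm_pullback_sq (m := m) hn hΩ hconf hF hw
  have hpow : ENNReal.ofReal r ^ n = ENNReal.ofReal r ^ (n - 1) * ENNReal.ofReal r := by
    rw [← pow_succ, Nat.sub_add_cancel hn]
  rw [meshSize_moveSimplex a hr, hpow]
  calc _ = ENNReal.ofReal r * meshSize F *
        (tangentialJumpNorm m 𝒯 F (pullback a r w) ^ 2 * ENNReal.ofReal r ^ (n - 1)) := by ring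
    _ = _ := by rw [h]; ring

theorem errorNorm_pullback_sq {T : Finset (Eucl n)} (hr : 0 < r)
    {v v' : SobolevZero m Ω} {w : PiecewiseFun n} (hw : ∀ K, ContDiff ℝ ∞ (w K))
    (hv : sobolevFn v =ᵐ[volume.restrict (hull T)] fun x => sobolevFn v' (homothetyMap a r x)) :
    errorNorm T v (pullback a r w) ^ 2 * ENNReal.ofReal r ^ n =
      (ENNReal.ofReal r ^ m) ^ 2 * errorNorm (moveSimplex a r T) v' w ^ 2 := by
  have hd := (hasWeakDeriv_sobolevDeriv v).ae_eq_hull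
    ((hasWeakDeriv_sobolevDeriv v').comp_homothetyMap a hr.ne') hv
  have h1 : errorNorm T v (pullback a r w) = eLpNorm (r ^ m • fun x =>
      (fun y => sobolevDeriv v' y - derivTensor m (w (moveSimplex a r T)) y)
        (homothetyMap a r x)) 2 (volume.restrict (hull T)) := by
    refine eLpNorm_congr_ae ?_
    filter_upwards [hd] with x hx
    have hpb : derivTensor m (pullback a r w T) x =
        r ^ m • derivTensor m (w (moveSimplex a r T)) (homothetyMap a r x) :=
      derivTensor_comp_homothetyMap m (hw _) a r x
    rw [hx, hpb, Pi.smul_apply, smul_sub]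
  have hcn : ‖r ^ m‖ₑ = ENNReal.ofReal r ^ m := by
    rw [Real.enorm_eq_ofReal (by positivity), ENNReal.ofReal_pow hr.le]
  rw [h1, eLpNorm_const_smul, hcn, mul_pow, mul_assoc, errorNorm, hull_moveSimplex,
    ← EuclideanSpace.euclideanHausdorffMeasure_eq_volume n,
    eLpNorm_comp_homothetyMap_sq n a hr
      (fun y => sobolevDeriv v' y - derivTensor m (w (moveSimplex a r T)) y)]

/-- Error and jump seminorm have the same scaling factor, which cancels, so the bound on `T'` pulls
back to `T`. -/
theorem companionConst_le_of_sameConfiguration [NeZero m] (hn : 0 < n)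
    (hΩ : IsLipschitzDomain Ω) {V : RegularTriangulation Ω → Submodule ℝ (PiecewiseFun n)}
    {J : LocalCompanion m V} {𝒯 𝒯' : RegularTriangulation Ω} {T T' : Finset (Eucl n)}
    (hconf : SameConfiguration a r 𝒯 T 𝒯' T')
    (hsm : ∀ w ∈ localSpace V 𝒯' T', ∀ K, ContDiff ℝ ∞ (w K))
    (hbound : ∀ w : localSpace V 𝒯' T',
      errorNorm T' (J 𝒯' T' w) w ≤ companionConst J 𝒯' T' * jumpSeminorm m 𝒯' T' w)
    (hspace : pullback a r '' (localSpace V 𝒯' T' : Set (PiecewiseFun n)) = localSpace V 𝒯 T)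
    (hJ : ∀ (w' : localSpace V 𝒯' T') (w : localSpace V 𝒯 T),
      (w : PiecewiseFun n) = pullback a r w' →
        sobolevFn (J 𝒯 T w) =ᵐ[volume.restrict (hull T)]
          fun x => sobolevFn (J 𝒯' T' w') (homothetyMap a r x)) :
    companionConst J 𝒯 T ≤ companionConst J 𝒯' T' := by
  have hr := hconf.pos
  refine sInf_le fun w => ?_
  obtain ⟨w', hw', hww'⟩ : (w : PiecewiseFun n) ∈
      pullback a r '' (localSpace V 𝒯' T' : Set (PiecewiseFun n)) := by
    rw [hspace]
    exact w.2
  have he := errorNorm_pullback_sq hr (hsm w' hw') (hJ ⟨w', hw'⟩ w hww'.symm)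
  have hj := jumpSeminorm_pullback_sq (m := m) hn hΩ hconf (hsm w' hw')
  rw [hconf.simplex] at he
  rw [hww'] at he hj
  have hR0 : ENNReal.ofReal r ^ n ≠ 0 := pow_ne_zero _ (by simpa using hr)
  have hRt : ENNReal.ofReal r ^ n ≠ ⊤ := ENNReal.pow_ne_top ENNReal.ofReal_ne_top
  have hsq : errorNorm T (J 𝒯 T w) w ^ 2 ≤
      (companionConst J 𝒯' T' * jumpSeminorm m 𝒯 T w) ^ 2 := by
    refine (ENNReal.mul_le_mul_iff_left hR0 hRt).1 ?_
    rw [he, mul_pow, mul_assoc, hj]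
    calc (ENNReal.ofReal r ^ m) ^ 2 * errorNorm T' (J 𝒯' T' ⟨w', hw'⟩) w' ^ 2
        ≤ (ENNReal.ofReal r ^ m) ^ 2 *
          (companionConst J 𝒯' T' * jumpSeminorm m 𝒯' T' w') ^ 2 := by
          gcongr
          exact hbound ⟨w', hw'⟩
      _ = _ := by ring
  have := ENNReal.rpow_le_rpow hsq (z := (1 / 2 : ℝ)) (by norm_num)
  rwa [sq_rpow_half, sq_rpow_half] at this

end Invariance

/-! ### Finitely many configurations -/

section Configurations

variable {n : ℕ} {Ω : Set (Eucl n)}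

theorem moveSimplex_inv (a : Eucl n) {r : ℝ} (hr : r ≠ 0) (T : Finset (Eucl n)) :
    moveSimplex (-(r⁻¹ • a)) r⁻¹ (moveSimplex a r T) = T := by
  rw [moveSimplex_moveSimplex, neg_add_cancel, inv_mul_cancel₀ hr, moveSimplex_zero_one]

theorem moveSimplices_inv (a : Eucl n) {r : ℝ} (hr : r ≠ 0) (S : Finset (Finset (Eucl n))) :
    moveSimplices (-(r⁻¹ • a)) r⁻¹ (moveSimplices a r S) = S := by
  rw [moveSimplices_moveSimplices, neg_add_cancel, inv_mul_cancel₀ hr, moveSimplices_zero_one]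

/-- The image of the configuration around `T` under `x ↦ a + r x`. -/
noncomputable def movedConfiguration (a : Eucl n) (r : ℝ) (𝒯 : RegularTriangulation Ω)
    (T : Finset (Eucl n)) : Finset (Eucl n) × Finset (Finset (Eucl n)) ×
      Finset (Finset (Eucl n)) × Finset (Eucl n) :=
  (moveSimplex a r T, moveSimplices a r (𝒯.patch T), moveSimplices a r (𝒯.localSides T),
    moveSimplex a r (𝒯.localBoundaryVertices T))

/-- Two configurations with a common normal form are related by the first homothety followed by the
inverse of the second. -/
theorem sameConfiguration_of_movedConfiguration_eq {a a' : Eucl n} {r r' : ℝ} (hr : 0 < r)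
    (hr' : 0 < r') {𝒯 𝒯' : RegularTriangulation Ω} {T T' : Finset (Eucl n)}
    (h : movedConfiguration a r 𝒯 T = movedConfiguration a' r' 𝒯' T') :
    SameConfiguration (-(r'⁻¹ • a') + r'⁻¹ • a) (r'⁻¹ * r) 𝒯 T 𝒯' T' := by
  simp only [movedConfiguration, Prod.mk.injEq] at h
  obtain ⟨h1, h2, h3, h4⟩ := h
  refine ⟨by positivity, ?_, ?_, ?_, ?_⟩
  · rw [← moveSimplex_moveSimplex, h1, moveSimplex_inv _ hr'.ne']
  · rw [← moveSimplices_moveSimplices, h2, moveSimplices_inv _ hr'.ne']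
  · rw [← moveSimplices_moveSimplices, h3, moveSimplices_inv _ hr'.ne']
  · rw [← moveSimplex_moveSimplex, h4, moveSimplex_inv _ hr'.ne']

theorem diam_simplex_pos (hn : 0 < n) {𝒯 : RegularTriangulation Ω} {T : Finset (Eucl n)}
    (hT : T ∈ 𝒯.simplices) : 0 < Metric.diam (T : Set (Eucl n)) := by
  obtain ⟨x, hx, y, hy, hxy⟩ := Finset.one_lt_card.1 (show 1 < T.card by
    rw [𝒯.card_eq T hT]; omega)
  exact (dist_pos.2 hxy).trans_le
    (Metric.dist_le_diam_of_mem T.finite_toSet.isBounded hx hy)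

/-- Normalise `T` to a reference simplex `S₀`. A neighbour at the vertex `z` lies in a scaled
reference patch that also contains `T`, as the image of some `S₁`; hence its normalised scale is
`diam S₀ / diam S₁` and its base point is a vertex of `S₀`. Both range over finite sets. -/
theorem exists_finite_movedConfiguration (hn : 0 < n) {𝕋 : Set (RegularTriangulation Ω)}
    (hA2 : FinitePatchConfigurations 𝕋) :
    ∃ X : Finset (Finset (Eucl n) × Finset (Finset (Eucl n)) ×
      Finset (Finset (Eucl n)) × Finset (Eucl n)),
      ∀ 𝒯 ∈ 𝕋, ∀ T ∈ 𝒯.simplices, ∃ (a : Eucl n) (r : ℝ), 0 < r ∧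
        movedConfiguration a r 𝒯 T ∈ X := by
  classical
  obtain ⟨N, C, hC⟩ := hA2
  let 𝒞 : Finset (Finset (Eucl n)) := Finset.univ.biUnion C
  let ratios : Finset ℝ := (𝒞 ×ˢ 𝒞).image fun S =>
    Metric.diam (S.1 : Set (Eucl n)) / Metric.diam (S.2 : Set (Eucl n))
  let 𝒦 : Finset (Finset (Eucl n)) := ((𝒞.biUnion id) ×ˢ ratios ×ˢ 𝒞).image fun q =>
    moveSimplex q.1 q.2.1 q.2.2
  refine ⟨𝒞 ×ˢ 𝒦.powerset ×ˢ (𝒦.biUnion sides).powerset ×ˢ (𝒦.biUnion id).powerset, ?_⟩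
  intro 𝒯 h𝒯 T hT
  obtain ⟨z₀, hz₀⟩ : T.Nonempty := Finset.card_pos.1 (by rw [𝒯.card_eq T hT]; omega)
  obtain ⟨j, h, hh, hj⟩ := hC 𝒯 h𝒯 T hT z₀ hz₀
  obtain ⟨S₀, hS₀, hTS₀⟩ : ∃ L ∈ C j, moveSimplex z₀ h L = T := by
    rw [← mem_moveSimplices, ← hj]
    exact RegularTriangulation.mem_nodalPatch.2 ⟨hT, hz₀⟩
  have hmem𝒞 : ∀ {j S}, S ∈ C j → S ∈ 𝒞 := fun {j S} hS =>
    Finset.mem_biUnion.2 ⟨j, Finset.mem_univ j, hS⟩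
  set a := -(h⁻¹ • z₀) with ha
  set r := h⁻¹ with hrdef
  have hr : 0 < r := by positivity
  have hTS : moveSimplex a r T = S₀ := by
    rw [← hTS₀]
    exact moveSimplex_inv z₀ hh.ne' S₀
  have hpatch : ∀ K ∈ 𝒯.patch T, moveSimplex a r K ∈ 𝒦 := by
    intro K hK
    obtain ⟨z, hz, hzK⟩ := (RegularTriangulation.mem_patch_iff_exists_common_vertex hT).1 hK
    obtain ⟨i, h', hh', hi⟩ := hC 𝒯 h𝒯 T hT z hz
    obtain ⟨S, hS, rfl⟩ : ∃ L ∈ C i, moveSimplex z h' L = K := by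
      rw [← mem_moveSimplices, ← hi]
      exact hzK
    obtain ⟨S₁, hS₁, hTS₁⟩ : ∃ L ∈ C i, moveSimplex z h' L = T := by
      rw [← mem_moveSimplices, ← hi]
      exact RegularTriangulation.mem_nodalPatch.2 ⟨hT, hz⟩
    have hdT := diam_simplex_pos hn hT
    have hd₁ : Metric.diam (T : Set (Eucl n)) = h' * Metric.diam (S₁ : Set (Eucl n)) := by
      rw [← hTS₁, coe_moveSimplex, diam_image_homothetyMap z hh']
    have hd₀ : Metric.diam (S₀ : Set (Eucl n)) = r * Metric.diam (T : Set (Eucl n)) := by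
      rw [← hTS, coe_moveSimplex, diam_image_homothetyMap a hr]
    have hne : Metric.diam (S₁ : Set (Eucl n)) ≠ 0 := by
      rintro h0
      rw [h0, mul_zero] at hd₁
      exact hdT.ne' hd₁
    -- Comparing the diameters of `T` in its two representations, by `S₀` and by `S₁`, determines
    -- the relative scale.
    have hratio : r * h' ∈ ratios := by
      refine Finset.mem_image.2 ⟨(S₀, S₁), Finset.mem_product.2 ⟨hmem𝒞 hS₀, hmem𝒞 hS₁⟩, ?_⟩
      simp only
      rw [hd₀, hd₁]
      field_simp
    have hvert : a + r • z ∈ 𝒞.biUnion id := by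
      refine Finset.mem_biUnion.2 ⟨S₀, hmem𝒞 hS₀, ?_⟩
      rw [id, ← hTS]
      exact Finset.mem_image.2 ⟨z, hz, rfl⟩
    rw [moveSimplex_moveSimplex]
    exact Finset.mem_image.2 ⟨(a + r • z, r * h', S), Finset.mem_product.2
      ⟨hvert, Finset.mem_product.2 ⟨hratio, hmem𝒞 hS⟩⟩, rfl⟩
  refine ⟨a, r, hr, ?_⟩
  simp only [movedConfiguration, Finset.mem_product, Finset.mem_powerset]
  refine ⟨hTS ▸ hmem𝒞 hS₀, ?_, ?_, ?_⟩
  · intro K hK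
    obtain ⟨L, hL, rfl⟩ := mem_moveSimplices.1 hK
    exact hpatch L hL
  · intro F hF
    obtain ⟨G, hG, rfl⟩ := mem_moveSimplices.1 hF
    obtain ⟨⟨K, hK, hGK⟩, -⟩ := RegularTriangulation.mem_localSides.1 hG
    exact Finset.mem_biUnion.2 ⟨_, hpatch K hK, (moveSimplex_mem_sides_iff a hr.ne').2 hGK⟩
  · intro y hy
    obtain ⟨z, hz, rfl⟩ := Finset.mem_image.1 hy
    obtain ⟨K, hK, hzK⟩ := Finset.mem_biUnion.1 (Finset.mem_filter.1 hz).1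
    exact Finset.mem_biUnion.2 ⟨_, hpatch K hK, Finset.mem_image.2 ⟨z, hzK, rfl⟩⟩

/-- One representative for each normal form bounds the constants of its whole class; forms that do
not occur receive the bound `0`. The sum over the finitely many forms dominates the supremum. -/
theorem uniformCompanionConst_lt_top {m k : ℕ} [NeZero m] (hn : 0 < n)
    (hΩ : IsLipschitzDomain Ω) {𝕋 : Set (RegularTriangulation Ω)}
    (hA2 : FinitePatchConfigurations 𝕋)
    {V : RegularTriangulation Ω → Submodule ℝ (PiecewiseFun n)}
    (hV : ∀ 𝒯 ∈ 𝕋, ∀ v ∈ V 𝒯, IsPiecewisePoly k 𝒯.simplices v) {J : LocalCompanion m V}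
    (hbound : ∀ 𝒯 ∈ 𝕋, ∀ T ∈ 𝒯.simplices, companionConst J 𝒯 T < ⊤ ∧
      ∀ w : localSpace V 𝒯 T,
        errorNorm T (J 𝒯 T w) w ≤ companionConst J 𝒯 T * jumpSeminorm m 𝒯 T w)
    (hdet : DeterminedByConfiguration J 𝕋) : uniformCompanionConst J 𝕋 < ⊤ := by
  classical
  obtain ⟨X, hX⟩ := exists_finite_movedConfiguration hn hA2
  have hex : ∀ c, ∃ B : ℝ≥0∞, B < ⊤ ∧ ∀ 𝒯 ∈ 𝕋, ∀ T ∈ 𝒯.simplices, ∀ (a : Eucl n) (r : ℝ),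
      0 < r → movedConfiguration a r 𝒯 T = c → companionConst J 𝒯 T ≤ B := by
    intro c
    by_cases hc : ∃ 𝒯 ∈ 𝕋, ∃ T ∈ 𝒯.simplices, ∃ (a : Eucl n) (r : ℝ), 0 < r ∧
        movedConfiguration a r 𝒯 T = c
    · obtain ⟨𝒯', h𝒯', T', hT', a', r', hr', rfl⟩ := hc
      refine ⟨companionConst J 𝒯' T', (hbound 𝒯' h𝒯' T' hT').1, ?_⟩
      intro 𝒯 h𝒯 T hT a r hr heq
      have hconf := sameConfiguration_of_movedConfiguration_eq hr hr' heq
      obtain ⟨hspace, hJ⟩ := hdet 𝒯 h𝒯 T hT 𝒯' h𝒯' T' hT' _ _ hconf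
      exact companionConst_le_of_sameConfiguration hn hΩ hconf
        (fun w hw => (isPiecewisePoly_of_mem_localSpace (hV 𝒯' h𝒯') T' hw).contDiff)
        (hbound 𝒯' h𝒯' T' hT').2 hspace hJ
    · exact ⟨0, ENNReal.zero_lt_top, fun 𝒯 h𝒯 T hT a r hr heq =>
        absurd ⟨𝒯, h𝒯, T, hT, a, r, hr, heq⟩ hc⟩
  choose B hBt hB using hex
  refine lt_of_le_of_lt (b := ∑ c ∈ X, B c) ?_ (ENNReal.sum_lt_top.2 fun c _ => hBt c)
  refine iSup₂_le fun 𝒯 h𝒯 => iSup₂_le fun T hT => ?_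
  obtain ⟨a, r, hr, hmem⟩ := hX 𝒯 h𝒯 T hT
  exact (hB _ 𝒯 h𝒯 T hT a r hr rfl).trans
    (Finset.single_le_sum (f := B) (fun _ _ => zero_le) hmem)

end Configurations

/-! ### The main theorem. -/

theorem mainTheorem4 {n m k : ℕ} [NeZero m] (hn : 2 ≤ n)
    (Ω : Set (Eucl n)) (hΩ : IsLipschitzDomain Ω)
    -- the family of triangulations, with finitely many patch configurations
    (𝕋 : Set (RegularTriangulation Ω)) (hA2 : FinitePatchConfigurations 𝕋)
    -- the discrete spaces `V(𝒯) ⊆ P_k(𝒯)`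
    (V : RegularTriangulation Ω → Submodule ℝ (PiecewiseFun n))
    (hV : ∀ 𝒯 ∈ 𝕋, ∀ v ∈ V 𝒯, IsPiecewisePoly k 𝒯.simplices v)
    -- the companion `J₂` and its local contributions `J_{2,T}`
    (J₂ : ∀ 𝒯 : RegularTriangulation Ω, V 𝒯 →ₗ[ℝ] SobolevZero m Ω)
    (J : LocalCompanion m V)
    (hlocal : ∀ 𝒯 ∈ 𝕋, ∀ T ∈ 𝒯.simplices, ∀ v : V 𝒯,
      sobolevFn (J₂ 𝒯 v) =ᵐ[volume.restrict (hull T)] sobolevFn (J 𝒯 T (toLocal V 𝒯 T v)))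
    -- exactness of `J_{2,T}` for conforming arguments
    (hC6 : ∀ 𝒯 ∈ 𝕋, ∀ T ∈ 𝒯.simplices, ∀ w : localSpace V 𝒯 T,
      IsLocallyConforming m V 𝒯 T w →
        sobolevFn (J 𝒯 T w) =ᵐ[volume.restrict (hull T)] (w : PiecewiseFun n) T)
    -- kernel inclusion for `μ_T`
    (hC7 : ∀ 𝒯 ∈ 𝕋, ∀ T ∈ 𝒯.simplices, ∀ w : localSpace V 𝒯 T,
      jumpSeminorm m 𝒯 T w = 0 → IsLocallyConforming m V 𝒯 T w) :
    -- `M₃` is finite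
    overlapConst 𝕋 < ⊤ ∧
    -- `ϱ_T ≤ C(T) μ_T` with finite constants `C(T)`
    (∀ 𝒯 ∈ 𝕋, ∀ T ∈ 𝒯.simplices, companionConst J 𝒯 T < ⊤ ∧
      ∀ w : localSpace V 𝒯 T,
        errorNorm T (J 𝒯 T w) w ≤ companionConst J 𝒯 T * jumpSeminorm m 𝒯 T w) ∧
    -- `C(𝕋)` is finite for spaces and companions that depend on the local configurations only
    (DeterminedByConfiguration J 𝕋 → uniformCompanionConst J 𝕋 < ⊤) ∧
    -- the estimate
    (∀ 𝒯 ∈ 𝕋, ∀ 𝒯' ∈ 𝕋, 𝒯'.IsRefinement 𝒯 →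
      ∀ (I : V 𝒯' → V 𝒯) (I' : SobolevZero m Ω → V 𝒯') (Λ₅ : ℝ≥0) (u : V 𝒯),
        -- the coarse interpolation `I` is the identity on non-refined simplices
        (∀ T ∈ 𝒯.simplices, T ∈ 𝒯'.simplices → ∀ v : V 𝒯', ∀ x ∈ hull T,
          (v : PiecewiseFun n) T x - (I v : PiecewiseFun n) T x = 0) →
        -- `I û* = u` for `û* = I' J₂ u`
        I (I' (J₂ 𝒯 u)) = u →
        -- stability of the fine interpolation `I'`
        (∀ T ∈ 𝒯.simplices, ∀ (v : SobolevZero m Ω) (w : V 𝒯),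
          brokenNorm m 𝒯' T (I' v) w ≤ Λ₅ * errorNorm T v w) →
        discreteNorm m 𝒯 𝒯' (I' (J₂ 𝒯 u)) u ^ 2 ≤
          (Λ₅ * uniformCompanionConst J 𝕋 * overlapConst 𝕋 ^ (1 / 2 : ℝ)) ^ 2 *
            ∑ T ∈ 𝒯.refinedLayer 𝒯', meshSize T *
              ∑ F ∈ sides T, tangentialJumpNorm m 𝒯 F u ^ 2) := by
  have hn0 : 0 < n := by omega
  have hconst : ∀ 𝒯 ∈ 𝕋, ∀ T ∈ 𝒯.simplices, companionConst J 𝒯 T < ⊤ ∧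
      ∀ w : localSpace V 𝒯 T,
        errorNorm T (J 𝒯 T w) w ≤ companionConst J 𝒯 T * jumpSeminorm m 𝒯 T w := by
    intro 𝒯 h𝒯 T hT
    obtain ⟨C, hC, hCw⟩ := exists_companion_bound hn (hV 𝒯 h𝒯) J T (hC6 𝒯 h𝒯 T hT)
      (hC7 𝒯 h𝒯 T hT)
    have hle : companionConst J 𝒯 T ≤ C := sInf_le hCw
    refine ⟨hle.trans_lt hC, fun w => ?_⟩
    -- Some finite constant is admissible and the seminorms are finite, so the infimum `C(T)` is
    -- attained.
    exact le_sInf_mul (fun w : localSpace V 𝒯 T => jumpSeminorm_ne_top hn 𝒯 T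
      (isPiecewisePoly_of_mem_localSpace (hV 𝒯 h𝒯) T w.2).contDiff) w ⟨C, hCw⟩
  refine ⟨overlapConst_lt_top hA2, hconst,
    uniformCompanionConst_lt_top hn0 hΩ hA2 hV hconst, ?_⟩
  intro 𝒯 h𝒯 𝒯' _ _ I I' Λ₅ u hC3 hC4 hC5
  exact discreteNorm_sq_le hn0 hΩ J₂ J h𝒯 (hlocal 𝒯 h𝒯) (fun T hT => (hconst 𝒯 h𝒯 T hT).2)
    I I' Λ₅ u hC3 hC4 hC5
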